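/- Let $\mathbb T=\mathbb R/2\pi\mathbb Z$. Write $f_j=\frac1{2\pi}\int_{\mathbb T}e^{-ijy}f(y)\,dy$, and let all $L^2$ norms be taken with respect to the normalised measure, so that $\|f\|_{L^2(\mathbb T)}^2=\frac1{2\pi}\int_{\mathbb T}|f|^2\,dy=\sum_j|f_j|^2$ and $\|f\|_{H^3}^2=\sum_j(1+j^2)^3|f_j|^2$. For a mean-free $f$, $\partial_y^{-1}f$ denotes its mean-free antiderivative. For $\nu,\alpha>0$ and real $U\in H^3(\mathbb T)$ let $\Delta_\alpha=\partial_{yy}+\alpha^2\partial_{xx}$ and consider on $L^2(\mathbb T^2)$ the Orr–Sommerfeld operator $$\mathcal L_{\nu,\alpha}=\nu\Delta_\alpha-\alpha\,\partial_x\big(U(y)-U''(y)\Delta_\alpha^{-1}\big),\qquad D(\mathcal L_{\nu,\alpha})=H^2(\mathbb T^2).$$ **Theorem.** Let $U\in H^3(\mathbb T)$ be real-valued with zero mean. There are constants $\delta_0\in(0,1)$ and $C\ge1$, depending only on (an upper bound for) $\|U\|_{H^3}$, such that for all $\nu,\alpha>0$ and $k\in\mathbb Z\setminus\{0\}$ with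 $$\|\partial_y^{-1}U\|_{L^2}>\nu\qquad\text{and}\qquad \alpha|k|\le\delta_0\nu$$ the following holds for the operator $\mathcal L_{\nu,\alpha}$ restricted to the class $\{e^{ikx}f(y):f\in L^2(\mathbb T)\}$. It has an algebraically simple eigenvalue $\lambda$ with $\operatorname{Re}\lambda>-\nu/2$ and an eigenfunction $e^{ikx}V(y)$, unique up to scalar multiples, such that $$\Big|\lambda-\frac{(\alpha k)^2}{\nu}\big(\|\partial_y^{-1}U\|_{L^2}^2-\nu^2\big)\Big|\le C\,\frac{(\alpha|k|)^3}{\nu^2},\qquad \|V-U\|_{L^2}\le C\,\frac{\alpha|k|}{\nu}.$$ The rest of the spectrum in this class is pure point (it consists of eigenvalues) and is contained in $\{\operatorname{Re}z\le-\nu/2\}$. In particular $\lambda$ is the only possible unstable point of the spectrum, and it is unstable, $\operatorname{Re}\lambda>0$, as soon as $C\,\alpha|k|/\nu<\|\partial_y^{-1}U\|_{L^2}^2-\nu^2$ (thus, for given $U$ and $\nu<\|\partial_y^{-1}U\|_{L^2}$, for all sufficiently small $\alpha|k|$). -/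

import Mathlib

open MeasureTheory AddCircle

noncomputable section

namespace OrrSommerfeld

/-! ### The torus, its normalised measure, and `L²` -/

instance fact_two_pi_pos : Fact (0 < 2 * Real.pi) := ⟨Real.two_pi_pos⟩

/-- The torus `𝕋 = ℝ / 2πℤ`. -/
abbrev Torus : Type := AddCircle (2 * Real.pi)

/-- The normalised measure `dy / 2π` on `𝕋`.  All `L²` norms are taken with respect to it, so
that Parseval's identity reads `‖f‖² = ∑ |f_j|²`. -/
abbrev tmeas : Measure Torus := haarAddCircle

/-- The normalised measure on `𝕋 × 𝕋`. -/
abbrev tmeas2 : Measure (Torus × Torus) := tmeas.prod tmeas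

/-- `L²(𝕋; ℂ)`. -/
abbrev L2T : Type := Lp ℂ 2 tmeas

/-- `L²(𝕋²; ℂ)`, with variables `(x, y)`. -/
abbrev L2T2 : Type := Lp ℂ 2 tmeas2

/-! ### Functions of one variable: Sobolev norms, `∂_y²`, `∂_y⁻¹` -/

/-- `f ∈ H^s(𝕋)`. -/
def MemH (s : ℕ) (f : L2T) : Prop :=
  Summable fun j : ℤ => (1 + (j : ℝ) ^ 2) ^ s * ‖fourierCoeff f j‖ ^ 2

/-- The `H^s(𝕋)` norm (meaningful when `MemH s f`). -/
def normH (s : ℕ) (f : L2T) : ℝ :=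
  Real.sqrt (∑' j : ℤ, (1 + (j : ℝ) ^ 2) ^ s * ‖fourierCoeff f j‖ ^ 2)

open Classical in
/-- The element of `L²(𝕋)` whose Fourier coefficients are a given square-summable family
(zero if the family is not square-summable). -/
def ofCoeff (a : ℤ → ℂ) : L2T :=
  if h : Memℓp a 2 then
    (fourierBasis (T := 2 * Real.pi)).repr.symm (⟨a, h⟩ : lp (fun _ : ℤ => ℂ) 2)
  else 0

theorem fourierCoeff_ofCoeff {a : ℤ → ℂ} (h : Memℓp a 2) (j : ℤ) :
    fourierCoeff (ofCoeff a) j = a j := by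
  rw [← fourierBasis_repr, ofCoeff, dif_pos h, LinearIsometryEquiv.apply_symm_apply]

/-- The second derivative `f''`, for `f ∈ H²(𝕋)`: Fourier coefficients `-j² f_j`. -/
def deriv2 (f : L2T) : L2T := ofCoeff fun j => -((j : ℂ) ^ 2) * fourierCoeff f j

/-- The mean-free antiderivative `∂_y⁻¹ f` of a mean-free `f`: Fourier coefficients
`f_j / (i j)` for `j ≠ 0`, and `0` for `j = 0`. -/
def antideriv (f : L2T) : L2T :=
  ofCoeff fun j => if j = 0 then 0 else fourierCoeff f j / (Complex.I * (j : ℂ))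

/-! ### Functions of two variables -/

/-- The Fourier coefficient of index `(m, n)` of a function on `𝕋²`, i.e. the normalised integral
of `e^{-imx} e^{-iny} f(x, y)`. -/
def coeff2 (f : Torus × Torus → ℂ) (m n : ℤ) : ℂ :=
  ∫ p, (fourier (-m) p.1 * fourier (-n) p.2) * f p ∂tmeas2

/-- `w ∈ H²(𝕋²)`. -/
def MemH2T2 (w : L2T2) : Prop :=
  Summable fun q : ℤ × ℤ => (1 + (q.1 : ℝ) ^ 2 + (q.2 : ℝ) ^ 2) ^ 2 * ‖coeff2 w q.1 q.2‖ ^ 2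

/-- The Fourier symbol of `Δ_α = ∂_yy + α² ∂_xx`. -/
def lapSymbol (α : ℝ) (m n : ℤ) : ℂ := -(((α * m) ^ 2 + (n : ℝ) ^ 2 : ℝ) : ℂ)

/-- `ψ = Δ_α⁻¹ w`: the mean-free `ψ ∈ L²(𝕋²)` with `Δ_α ψ = w` up to the mean of `w`. -/
def IsStream (α : ℝ) (w ψ : L2T2) : Prop :=
  coeff2 ψ 0 0 = 0 ∧
    ∀ m n : ℤ, (m, n) ≠ (0, 0) → lapSymbol α m n * coeff2 ψ m n = coeff2 w m n

theorem integrable_fourier_mul {f : Torus × Torus → ℂ} (hf : Integrable f tmeas2) (m n : ℤ) :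
    Integrable (fun p => (fourier (-m) p.1 * fourier (-n) p.2) * f p) tmeas2 := by
  refine hf.bdd_mul (c := 1) ?_ (Filter.Eventually.of_forall fun p => ?_)
  · exact (Continuous.aestronglyMeasurable (by fun_prop))
  · simp only [fourier_apply, norm_mul, Circle.norm_coe, mul_one, le_refl]

theorem coeff2_add {f g : Torus × Torus → ℂ} (hf : Integrable f tmeas2)
    (hg : Integrable g tmeas2) (m n : ℤ) :
    coeff2 (f + g) m n = coeff2 f m n + coeff2 g m n := by
  unfold coeff2
  rw [← integral_add (integrable_fourier_mul hf m n) (integrable_fourier_mul hg m n)]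
  simp [mul_add]

theorem coeff2_smul (c : ℂ) (f : Torus × Torus → ℂ) (m n : ℤ) :
    coeff2 (c • f) m n = c * coeff2 f m n := by
  unfold coeff2
  rw [← integral_const_mul]
  congr 1
  funext p
  simp only [Pi.smul_apply, smul_eq_mul]
  ring

theorem coeff2_congr {f g : Torus × Torus → ℂ} (h : f =ᵐ[tmeas2] g) (m n : ℤ) :
    coeff2 f m n = coeff2 g m n :=
  integral_congr_ae (by filter_upwards [h] with p hp; rw [hp])

theorem L2T2.integrable (w : L2T2) : Integrable w tmeas2 :=
  (Lp.memLp w).integrable (by norm_num)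

theorem coeff2_coe_add (v w : L2T2) (m n : ℤ) :
    coeff2 (v + w : L2T2) m n = coeff2 v m n + coeff2 w m n := by
  rw [coeff2_congr (Lp.coeFn_add v w), coeff2_add (L2T2.integrable v) (L2T2.integrable w)]

theorem coeff2_coe_smul (c : ℂ) (w : L2T2) (m n : ℤ) :
    coeff2 (c • w : L2T2) m n = c * coeff2 w m n := by
  rw [coeff2_congr (Lp.coeFn_smul c w), coeff2_smul]

theorem coeff2_coe_zero (m n : ℤ) : coeff2 (0 : L2T2) m n = 0 := by
  simpa using coeff2_coe_smul 0 0 m n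

/-- `(x, y) ↦ U(y) w(x, y) - W(y) ψ(x, y)`. -/
def transport (U W : L2T) (w ψ : L2T2) : Torus × Torus → ℂ :=
  fun p => U p.2 * w p - W p.2 * ψ p

theorem integrable_snd_mul (U : L2T) (w : L2T2) :
    Integrable (fun p : Torus × Torus => U p.2 * w p) tmeas2 :=
  ((Lp.memLp U).comp_snd tmeas).integrable_mul (Lp.memLp w)

theorem integrable_transport (U W : L2T) (w ψ : L2T2) :
    Integrable (transport U W w ψ) tmeas2 :=
  (integrable_snd_mul U w).sub (integrable_snd_mul W ψ)

theorem transport_add (U W : L2T) (w w' ψ ψ' : L2T2) :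
    transport U W (w + w') (ψ + ψ') =ᵐ[tmeas2] transport U W w ψ + transport U W w' ψ' := by
  filter_upwards [Lp.coeFn_add w w', Lp.coeFn_add ψ ψ'] with p h h'
  simp only [transport, Pi.add_apply, h, h']
  ring

theorem transport_smul (U W : L2T) (c : ℂ) (w ψ : L2T2) :
    transport U W (c • w) (c • ψ) =ᵐ[tmeas2] c • transport U W w ψ := by
  filter_upwards [Lp.coeFn_smul c w, Lp.coeFn_smul c ψ] with p h h'
  simp only [transport, Pi.smul_apply, smul_eq_mul, h, h']
  ring

theorem MemH2T2.add {v w : L2T2} (hv : MemH2T2 v) (hw : MemH2T2 w) : MemH2T2 (v + w) := by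
  refine Summable.of_nonneg_of_le (fun q => by positivity) (fun q => ?_)
    ((Summable.add hv hw).mul_left 2)
  rw [coeff2_coe_add, ← mul_add, mul_left_comm]
  refine mul_le_mul_of_nonneg_left ?_ (by positivity)
  have h := norm_add_le (coeff2 v q.1 q.2) (coeff2 w q.1 q.2)
  nlinarith [sq_nonneg (‖coeff2 v q.1 q.2‖ - ‖coeff2 w q.1 q.2‖),
    norm_nonneg (coeff2 v q.1 q.2 + coeff2 w q.1 q.2)]

theorem MemH2T2.smul (c : ℂ) {w : L2T2} (hw : MemH2T2 w) : MemH2T2 (c • w) := by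
  refine (hw.mul_left (‖c‖ ^ 2)).congr fun q => ?_
  rw [coeff2_coe_smul, norm_mul]
  ring

/-! ### The Orr–Sommerfeld operator on `L²(𝕋²)` -/

/-- The graph of `𝓛_{ν,α} = ν Δ_α - α ∂_x (U - U'' Δ_α⁻¹)` with domain `H²(𝕋²)`: the pairs
`(w, g)` with `w ∈ H²`, `g ∈ L²` and `g = ν Δ_α w - α ∂_x (U w - U'' ψ)`, `ψ = Δ_α⁻¹ w`, the
equality being that of Fourier coefficients. -/
def graph (U : L2T) (ν α : ℝ) : Submodule ℂ (L2T2 × L2T2) where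
  carrier := {q | MemH2T2 q.1 ∧ ∃ ψ : L2T2, IsStream α q.1 ψ ∧ ∀ m n : ℤ,
    coeff2 q.2 m n = ν * (lapSymbol α m n * coeff2 q.1 m n)
      - α * (Complex.I * m * coeff2 (transport U (deriv2 U) q.1 ψ) m n)}
  zero_mem' := by
    refine ⟨?_, 0, ⟨coeff2_coe_zero 0 0, fun m n _ => ?_⟩, fun m n => ?_⟩
    · simp only [MemH2T2, Prod.fst_zero, coeff2_coe_zero]
      simp
    · simp only [Prod.fst_zero, coeff2_coe_zero, mul_zero]
    · have h : coeff2 (transport U (deriv2 U) 0 0) m n = 0 := by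
        have := coeff2_congr (transport_smul U (deriv2 U) 0 0 0) m n
        rw [coeff2_smul] at this
        simpa using this
      simp only [Prod.fst_zero, Prod.snd_zero, coeff2_coe_zero, h, mul_zero, sub_zero]
  add_mem' := by
    rintro ⟨w, g⟩ ⟨w', g'⟩ ⟨hw, ψ, ⟨h0, hψ⟩, hg⟩ ⟨hw', ψ', ⟨h0', hψ'⟩, hg'⟩
    refine ⟨hw.add hw', ψ + ψ', ⟨?_, fun m n hmn => ?_⟩, fun m n => ?_⟩
    · rw [coeff2_coe_add, h0, h0', add_zero]
    · simp only [Prod.mk_add_mk, coeff2_coe_add, mul_add, hψ m n hmn, hψ' m n hmn]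
    · have h := hg m n
      have h' := hg' m n
      simp only at h h'
      simp only [Prod.mk_add_mk]
      rw [coeff2_coe_add, coeff2_coe_add, coeff2_congr (transport_add _ _ _ _ _ _),
        coeff2_add (integrable_transport _ _ _ _) (integrable_transport _ _ _ _), h, h']
      ring
  smul_mem' := by
    rintro c ⟨w, g⟩ ⟨hw, ψ, ⟨h0, hψ⟩, hg⟩
    refine ⟨hw.smul c, c • ψ, ⟨?_, fun m n hmn => ?_⟩, fun m n => ?_⟩
    · rw [coeff2_coe_smul, h0, mul_zero]
    · have h := hψ m n hmn
      simp only at h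
      simp only [Prod.smul_mk, coeff2_coe_smul]
      rw [← h]
      ring
    · have h := hg m n
      simp only at h
      simp only [Prod.smul_mk]
      rw [coeff2_coe_smul, coeff2_coe_smul, coeff2_congr (transport_smul _ _ _ _ _),
        coeff2_smul, h]
      ring

/-- The Orr–Sommerfeld operator `𝓛_{ν,α}` as an unbounded operator on `L²(𝕋²)`; see
`graph_orrSommerfeld` below. -/
def orrSommerfeld (U : L2T) (ν α : ℝ) : L2T2 →ₗ.[ℂ] L2T2 := (graph U ν α).toLinearPMap

/-! The Fourier coefficients determine an element of `L²(𝕋²)`, hence `graph` is the graph of an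
operator. -/

theorem ae_eq_zero_of_fourierCoeff {f : Torus → ℂ} (hf : MemLp f 2 tmeas)
    (h : ∀ n, fourierCoeff f n = 0) : f =ᵐ[tmeas] 0 := by
  have h0 : hf.toLp f = 0 := by
    apply (fourierBasis (T := 2 * Real.pi)).repr.injective
    ext n
    rw [fourierBasis_repr, fourierCoeff_congr_ae hf.coeFn_toLp, h]
    simp
  exact hf.coeFn_toLp.symm.trans (h0 ▸ Lp.coeFn_zero ℂ 2 tmeas)

theorem norm_fourierCoeff_sq_le {f : Torus → ℂ} (hf : MemLp f 2 tmeas) (n : ℤ) :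
    ‖fourierCoeff f n‖ ^ 2 ≤ ∫ y, ‖f y‖ ^ 2 ∂tmeas := by
  have h := hasSum_sq_fourierCoeff (hf.toLp f)
  rw [fourierCoeff_congr_ae hf.coeFn_toLp] at h
  have h2 : ∫ y, ‖(hf.toLp f) y‖ ^ 2 ∂tmeas = ∫ y, ‖f y‖ ^ 2 ∂tmeas :=
    integral_congr_ae (by filter_upwards [hf.coeFn_toLp] with y hy; rw [hy])
  rw [← h2]
  exact le_hasSum h n fun _ _ => by positivity

theorem eq_zero_of_coeff2 (w : L2T2) (h : ∀ m n, coeff2 w m n = 0) : w = 0 := by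
  have hsq : Integrable (fun p => ‖w p‖ ^ 2) tmeas2 :=
    (memLp_two_iff_integrable_sq_norm (Lp.memLp w).1).1 (Lp.memLp w)
  have hsec : ∀ᵐ x ∂tmeas, MemLp (fun y => w (x, y)) 2 tmeas := by
    filter_upwards [(Lp.memLp w).1.prodMk_left, hsq.prod_right_ae] with x h1 h2
    exact (memLp_two_iff_integrable_sq_norm h1).2 h2
  have hcoeff : ∀ n, (fun x => fourierCoeff (fun y => w (x, y)) n) =ᵐ[tmeas] 0 := by
    intro n
    have hint : Integrable (fun p : Torus × Torus => fourier (-n) p.2 • w p) tmeas2 := by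
      simpa using integrable_fourier_mul (L2T2.integrable w) 0 n
    have hmeas : AEStronglyMeasurable (fun x => fourierCoeff (fun y => w (x, y)) n) tmeas :=
      hint.1.integral_prod_right'
    refine ae_eq_zero_of_fourierCoeff ((memLp_two_iff_integrable_sq_norm hmeas).2 ?_) fun m => ?_
    · refine hsq.integral_prod_left.mono' (hmeas.norm.pow 2) ?_
      filter_upwards [hsec] with x hx
      rw [Real.norm_of_nonneg (by positivity)]
      exact norm_fourierCoeff_sq_le hx n
    · rw [← h m n, coeff2, integral_prod _ (integrable_fourier_mul (L2T2.integrable w) m n)]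
      simp only [fourierCoeff, smul_eq_mul, mul_assoc, integral_const_mul]
  have hae : ∀ᵐ x ∂tmeas, ∀ᵐ y ∂tmeas, w (x, y) = 0 := by
    filter_upwards [hsec, ae_all_iff.2 hcoeff] with x hx hx'
    exact ae_eq_zero_of_fourierCoeff hx hx'
  have hz : ∫ p, ‖w p‖ ^ 2 ∂tmeas2 = 0 := by
    rw [integral_prod _ hsq]
    refine integral_eq_zero_of_ae ?_
    filter_upwards [hae] with x hx
    refine integral_eq_zero_of_ae ?_
    filter_upwards [hx] with y hy
    simp [hy]
  rw [integral_eq_zero_iff_of_nonneg (fun _ => by positivity) hsq] at hz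
  refine Lp.ext ?_
  filter_upwards [hz, Lp.coeFn_zero ℂ 2 tmeas2] with p hp hp'
  rw [hp']
  simpa using hp

theorem graph_orrSommerfeld (U : L2T) (ν : ℝ) {α : ℝ} (hα : α ≠ 0) :
    (orrSommerfeld U ν α).graph = graph U ν α := by
  refine Submodule.toLinearPMap_graph_eq _ ?_
  rintro ⟨w, g⟩ ⟨-, ψ, ⟨h0, hψ⟩, hg⟩ hw
  simp only at hw
  subst hw
  have hψ0 : ψ = 0 := by
    refine eq_zero_of_coeff2 ψ fun m n => ?_
    by_cases hmn : (m, n) = (0, 0)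
    · simp only [Prod.mk.injEq] at hmn
      rw [hmn.1, hmn.2, h0]
    · have h := hψ m n hmn
      simp only [coeff2_coe_zero, mul_eq_zero] at h
      refine h.resolve_left ?_
      unfold lapSymbol
      rw [neg_eq_zero, Complex.ofReal_eq_zero]
      intro h'
      have hm : (α * m) ^ 2 = 0 := by nlinarith [sq_nonneg (α * m), sq_nonneg (n : ℝ)]
      have hn : (n : ℝ) ^ 2 = 0 := by nlinarith [sq_nonneg (α * m), sq_nonneg (n : ℝ)]
      refine hmn (Prod.ext ?_ ?_)
      · simpa [hα] using hm
      · simpa using hn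
  subst hψ0
  refine eq_zero_of_coeff2 g fun m n => ?_
  have h : coeff2 (transport U (deriv2 U) 0 0) m n = 0 := by
    have := coeff2_congr (transport_smul U (deriv2 U) 0 0 0) m n
    rw [coeff2_smul] at this
    simpa using this
  have h' := hg m n
  simp only [coeff2_coe_zero, h, mul_zero, sub_zero] at h'
  exact h'

/-! ### The class `{e^{ikx} f(y) : f ∈ L²(𝕋)}` -/

theorem memLp_mode (k : ℤ) (f : L2T) :
    MemLp (fun p : Torus × Torus => fourier k p.1 * f p.2) 2 tmeas2 := by
  have h := (Lp.memLp f).comp_snd (μ := tmeas)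
  refine h.of_le ?_ (Filter.Eventually.of_forall fun p => ?_)
  · exact AEStronglyMeasurable.mul (Continuous.aestronglyMeasurable (by fun_prop)) h.1
  · simp only [fourier_apply, norm_mul, Circle.norm_coe, one_mul, le_refl]

/-- The map `f ↦ e^{ikx} f(y)`. -/
def mode (k : ℤ) : L2T →ₗ[ℂ] L2T2 where
  toFun f := (memLp_mode k f).toLp _
  map_add' f g := by
    rw [← MemLp.toLp_add, MemLp.toLp_eq_toLp_iff]
    have h := (Measure.quasiMeasurePreserving_snd (μ := tmeas) (ν := tmeas)).ae_eq_comp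
      (Lp.coeFn_add f g)
    filter_upwards [h] with p hp
    simp only [Function.comp, Pi.add_apply] at hp
    simp only [Pi.add_apply, hp, mul_add]
  map_smul' c f := by
    rw [RingHom.id_apply, ← MemLp.toLp_const_smul, MemLp.toLp_eq_toLp_iff]
    have h := (Measure.quasiMeasurePreserving_snd (μ := tmeas) (ν := tmeas)).ae_eq_comp
      (Lp.coeFn_smul c f)
    filter_upwards [h] with p hp
    simp only [Function.comp, Pi.smul_apply, smul_eq_mul] at hp
    simp only [Pi.smul_apply, smul_eq_mul, hp]
    ring

/-- The class `{e^{ikx} f(y) : f ∈ L²(𝕋)}`. -/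
def modeClass (k : ℤ) : Submodule ℂ L2T2 := LinearMap.range (mode k)

/-! ### Spectral notions for unbounded operators -/

section Spectral

variable {E : Type*} [NormedAddCommGroup E] [NormedSpace ℂ E]

/-- The part of an unbounded operator `A` in a subspace `K`: its domain is
`{f ∈ K : f ∈ D(A), A f ∈ K}`, where it acts as `A`. -/
def part (A : E →ₗ.[ℂ] E) (K : Submodule ℂ E) : K →ₗ.[ℂ] K where
  domain :=
    { carrier := {f | ∃ h : (f : E) ∈ A.domain, A ⟨f, h⟩ ∈ K}
      zero_mem' := ⟨A.domain.zero_mem, by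
        have h : A ⟨((0 : K) : E), A.domain.zero_mem⟩ = 0 := A.map_zero
        rw [h]
        exact K.zero_mem⟩
      add_mem' := by
        rintro f g ⟨hf, hf'⟩ ⟨hg, hg'⟩
        refine ⟨A.domain.add_mem hf hg, ?_⟩
        have h : A ⟨((f + g : K) : E), A.domain.add_mem hf hg⟩ = A ⟨f, hf⟩ + A ⟨g, hg⟩ :=
          A.map_add ⟨f, hf⟩ ⟨g, hg⟩
        rw [h]
        exact K.add_mem hf' hg'
      smul_mem' := by
        rintro c f ⟨hf, hf'⟩
        refine ⟨A.domain.smul_mem c hf, ?_⟩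
        have h : A ⟨((c • f : K) : E), A.domain.smul_mem c hf⟩ = c • A ⟨f, hf⟩ :=
          A.map_smul c ⟨f, hf⟩
        rw [h]
        exact K.smul_mem c hf' }
  toFun :=
    { toFun := fun f => ⟨A ⟨(f : K), f.2.choose⟩, f.2.choose_spec⟩
      map_add' := fun f g => Subtype.ext (A.map_add ⟨(f : K), f.2.choose⟩ ⟨(g : K), g.2.choose⟩)
      map_smul' := fun c f => Subtype.ext (A.map_smul c ⟨(f : K), f.2.choose⟩) }

theorem part_apply (A : E →ₗ.[ℂ] E) (K : Submodule ℂ E) (f : (part A K).domain) :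
    (part A K f : E) = A ⟨((f : K) : E), f.2.choose⟩ := rfl

/-- `z` is in the resolvent set of `A`: `A - z : D(A) → E` is a bijection with bounded inverse. -/
def InResolventSet (A : E →ₗ.[ℂ] E) (z : ℂ) : Prop :=
  ∃ R : E →L[ℂ] E, (∀ g : E, ∃ f : A.domain, (f : E) = R g ∧ A f - z • (f : E) = g) ∧
    ∀ f : A.domain, R (A f - z • (f : E)) = f

/-- The spectrum of an unbounded operator. -/
def spec (A : E →ₗ.[ℂ] E) : Set ℂ := {z | ¬ InResolventSet A z}

/-- `f` is an eigenvector of `A` with eigenvalue `z`. -/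
def IsEigenvector (A : E →ₗ.[ℂ] E) (z : ℂ) (f : E) : Prop :=
  f ≠ 0 ∧ ∃ h : f ∈ A.domain, A ⟨f, h⟩ = z • f

/-- `z` is an eigenvalue of `A`. -/
def IsEigenvalue (A : E →ₗ.[ℂ] E) (z : ℂ) : Prop := ∃ f, IsEigenvector A z f

/-- `z` is an algebraically simple eigenvalue of `A`: the eigenvectors are the nonzero multiples
of a single one, and there is no Jordan chain of length two, i.e. no solution of
`(A - z) h = f` with `f` an eigenvector. -/
def IsSimpleEigenvalue (A : E →ₗ.[ℂ] E) (z : ℂ) : Prop :=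
  (∃ f, IsEigenvector A z f ∧ ∀ g, IsEigenvector A z g → ∃ c : ℂ, g = c • f) ∧
    ∀ (h : A.domain) (f : E), IsEigenvector A z f → A h - z • (h : E) ≠ f

end Spectral

/-- The operator `𝓛_{ν,α}` in the class `{e^{ikx} f(y)}`. -/
def orrSommerfeldMode (U : L2T) (ν α : ℝ) (k : ℤ) : modeClass k →ₗ.[ℂ] modeClass k :=
  part (orrSommerfeld U ν α) (modeClass k)

/-- `e^{ikx} f(y)` as an element of the class. -/
def modeElem (k : ℤ) (f : L2T) : modeClass k := ⟨mode k f, LinearMap.mem_range_self _ f⟩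

end OrrSommerfeld

end

noncomputable section

namespace OrrSommerfeld

/-! ### Fourier coefficients and Fourier multipliers on `L²(𝕋)` -/

/-- The Fourier coefficient of index `n` as a continuous linear functional on `L²(𝕋)`. -/
def coeffL (n : ℤ) : L2T →L[ℂ] ℂ := innerSL ℂ (fourierBasis (T := 2 * Real.pi) n)

theorem coeffL_apply (n : ℤ) (f : L2T) : coeffL n f = fourierCoeff f n := by
  rw [← fourierBasis_repr, HilbertBasis.repr_apply_apply]
  rfl

theorem fourierCoeff_coe_add (f g : L2T) (n : ℤ) :
    fourierCoeff (f + g : L2T) n = fourierCoeff f n + fourierCoeff g n := by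
  simp only [← coeffL_apply, map_add]

theorem fourierCoeff_coe_sub (f g : L2T) (n : ℤ) :
    fourierCoeff (f - g : L2T) n = fourierCoeff f n - fourierCoeff g n := by
  simp only [← coeffL_apply, map_sub]

theorem fourierCoeff_coe_neg (f : L2T) (n : ℤ) :
    fourierCoeff (-f : L2T) n = -fourierCoeff f n := by
  simp only [← coeffL_apply, map_neg]

theorem fourierCoeff_coe_smul (c : ℂ) (f : L2T) (n : ℤ) :
    fourierCoeff (c • f : L2T) n = c * fourierCoeff f n := by
  simp only [← coeffL_apply, map_smul, smul_eq_mul]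

theorem fourierCoeff_coe_zero (n : ℤ) : fourierCoeff (0 : L2T) n = 0 := by
  simp only [← coeffL_apply, map_zero]

theorem fourierCoeff_ext {f g : L2T} (h : ∀ n, fourierCoeff f n = fourierCoeff g n) : f = g := by
  apply (fourierBasis (T := 2 * Real.pi)).repr.injective
  ext n
  rw [fourierBasis_repr, fourierBasis_repr, h]

theorem memℓp_fourierCoeff (f : L2T) : Memℓp (fun n => fourierCoeff f n) 2 := by
  have h := ((fourierBasis (T := 2 * Real.pi)).repr f).2
  exact (funext fun n => fourierBasis_repr f n : _ = fun n => fourierCoeff f n) ▸ h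

theorem hasSum_norm_sq (f : L2T) : HasSum (fun n => ‖fourierCoeff f n‖ ^ 2) (‖f‖ ^ 2) := by
  have h := lp.hasSum_norm (p := 2) (by norm_num) ((fourierBasis (T := 2 * Real.pi)).repr f)
  simpa only [fourierBasis_repr, LinearIsometryEquiv.norm_map, ENNReal.toReal_ofNat,
    Real.rpow_ofNat] using h

theorem le_of_sq_le_sq {a b : ℝ} (h : a ^ 2 ≤ b ^ 2) (hb : 0 ≤ b) : a ≤ b :=
  (abs_le.1 (abs_le_of_sq_le_sq h hb)).2

theorem norm_fourierCoeff_le (f : L2T) (n : ℤ) : ‖fourierCoeff f n‖ ≤ ‖f‖ :=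
  le_of_sq_le_sq (le_hasSum (hasSum_norm_sq f) n fun _ _ => by positivity) (norm_nonneg _)

theorem norm_le_of_fourierCoeff_le {f g : L2T} {c : ℝ} (hc : 0 ≤ c)
    (h : ∀ n, ‖fourierCoeff f n‖ ≤ c * ‖fourierCoeff g n‖) : ‖f‖ ≤ c * ‖g‖ := by
  refine le_of_sq_le_sq ?_ (by positivity)
  rw [mul_pow]
  refine hasSum_le (fun n => ?_) (hasSum_norm_sq f) ((hasSum_norm_sq g).mul_left (c ^ 2))
  rw [← mul_pow]
  exact pow_le_pow_left₀ (norm_nonneg _) (h n) 2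

theorem memℓp_mul {s a : ℤ → ℂ} {c : ℝ} (hs : ∀ n, ‖s n‖ ≤ c) (ha : Memℓp a 2) :
    Memℓp (fun n => s n * a n) 2 := by
  have h2 : (0 : ℝ) < (2 : ENNReal).toReal := by norm_num
  refine memℓp_gen ?_
  refine Summable.of_nonneg_of_le (fun n => by positivity) (fun n => ?_)
    ((ha.summable h2).mul_left (c ^ 2))
  have hc : 0 ≤ c := (norm_nonneg _).trans (hs n)
  simp only [ENNReal.toReal_ofNat, Real.rpow_ofNat, norm_mul, mul_pow]
  exact mul_le_mul_of_nonneg_right (pow_le_pow_left₀ (norm_nonneg _) (hs n) 2) (by positivity)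

/-- The Fourier multiplier with a bounded symbol `s`. -/
def fmul (s : ℤ → ℂ) (hs : ∃ c, ∀ n, ‖s n‖ ≤ c) : L2T →L[ℂ] L2T :=
  LinearMap.mkContinuousOfExistsBound
    { toFun := fun f => ofCoeff fun n => s n * fourierCoeff f n
      map_add' := fun f g => fourierCoeff_ext fun n => by
        obtain ⟨c, hc⟩ := hs
        have h (f : L2T) := memℓp_mul hc (memℓp_fourierCoeff f)
        rw [fourierCoeff_coe_add, fourierCoeff_ofCoeff (h _), fourierCoeff_ofCoeff (h _),
          fourierCoeff_ofCoeff (h _), fourierCoeff_coe_add, mul_add]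
      map_smul' := fun a f => fourierCoeff_ext fun n => by
        obtain ⟨c, hc⟩ := hs
        have h (f : L2T) := memℓp_mul hc (memℓp_fourierCoeff f)
        rw [RingHom.id_apply, fourierCoeff_coe_smul, fourierCoeff_ofCoeff (h _),
          fourierCoeff_ofCoeff (h _), fourierCoeff_coe_smul]
        ring } <| by
    obtain ⟨c, hc⟩ := hs
    have h (f : L2T) := memℓp_mul hc (memℓp_fourierCoeff f)
    refine ⟨c, fun f => norm_le_of_fourierCoeff_le ((norm_nonneg _).trans (hc 0)) fun n => ?_⟩
    change ‖fourierCoeff (ofCoeff fun n => s n * fourierCoeff f n) n‖ ≤ _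
    rw [fourierCoeff_ofCoeff (h _), norm_mul]
    exact mul_le_mul_of_nonneg_right (hc n) (norm_nonneg _)

theorem fourierCoeff_fmul {s : ℤ → ℂ} (hs : ∃ c, ∀ n, ‖s n‖ ≤ c) (f : L2T) (n : ℤ) :
    fourierCoeff (fmul s hs f) n = s n * fourierCoeff f n := by
  obtain ⟨c, hc⟩ := hs
  exact fourierCoeff_ofCoeff (memℓp_mul hc (memℓp_fourierCoeff f)) n

theorem norm_fmul_le {s : ℤ → ℂ} (hs : ∃ c, ∀ n, ‖s n‖ ≤ c) {c : ℝ} (hc : ∀ n, ‖s n‖ ≤ c) :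
    ‖fmul s hs‖ ≤ c := by
  have hc0 : 0 ≤ c := (norm_nonneg _).trans (hc 0)
  refine ContinuousLinearMap.opNorm_le_bound _ hc0 fun f => ?_
  refine norm_le_of_fourierCoeff_le hc0 fun n => ?_
  rw [fourierCoeff_fmul, norm_mul]
  exact mul_le_mul_of_nonneg_right (hc n) (norm_nonneg _)

/-- The constant function `1`. -/
def one : L2T := fourierBasis (T := 2 * Real.pi) 0

theorem fourierCoeff_fourierBasis (m n : ℤ) :
    fourierCoeff (fourierBasis (T := 2 * Real.pi) m : L2T) n = if n = m then 1 else 0 := by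
  rw [← coeffL_apply, coeffL, innerSL_apply_apply]
  exact orthonormal_iff_ite.1 (fourierBasis (T := 2 * Real.pi)).orthonormal n m

theorem fourierCoeff_one (n : ℤ) : fourierCoeff one n = if n = 0 then 1 else 0 :=
  fourierCoeff_fourierBasis 0 n

theorem norm_one_L2T : ‖one‖ = 1 := (fourierBasis (T := 2 * Real.pi)).orthonormal.1 0

theorem isCompactOperator_fmul {s : ℤ → ℂ} (hs : ∃ c, ∀ n, ‖s n‖ ≤ c)
    (h : Filter.Tendsto s Filter.cofinite (nhds 0)) : IsCompactOperator (fmul s hs) := by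
  classical
  have hrank (n : ℤ) : IsCompactOperator
      ((coeffL n).smulRight (fourierBasis (T := 2 * Real.pi) n) : L2T →L[ℂ] L2T) := by
    have := (isCompactOperator_of_locallyCompactSpace_rng
      (ContinuousLinearMap.toSpanSingleton ℂ (fourierBasis (T := 2 * Real.pi) n))).comp_clm
        (coeffL n)
    exact this
  have hsum (F : Finset ℤ) : IsCompactOperator (∑ n ∈ F,
      s n • (coeffL n).smulRight (fourierBasis (T := 2 * Real.pi) n) : L2T →L[ℂ] L2T) := by
    induction F using Finset.induction_on with
    | empty => simpa using isCompactOperator_zero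
    | insert a F ha ih =>
      rw [Finset.sum_insert ha]
      exact ((hrank a).smul (s a)).add ih
  refine isCompactOperator_of_tendsto (l := Filter.atTop) (F := fun F : Finset ℤ => ∑ n ∈ F,
      s n • (coeffL n).smulRight (fourierBasis (T := 2 * Real.pi) n)) ?_
    (Filter.Eventually.of_forall hsum)
  rw [Metric.tendsto_atTop]
  intro ε hε
  have hfin : {n | ¬ ‖s n‖ < ε / 2}.Finite := by
    have := h.norm.eventually_lt_const (u := ε / 2) (by simpa using hε)
    exact this
  refine ⟨hfin.toFinset, fun F hF => ?_⟩
  rw [dist_eq_norm]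
  refine lt_of_le_of_lt (ContinuousLinearMap.opNorm_le_bound _ (half_pos hε).le fun f =>
    norm_le_of_fourierCoeff_le (half_pos hε).le fun n => ?_) (half_lt_self hε)
  have hc : fourierCoeff ((∑ n ∈ F, s n •
      (coeffL n).smulRight (fourierBasis (T := 2 * Real.pi) n) : L2T →L[ℂ] L2T) f) n
      = if n ∈ F then s n * fourierCoeff f n else 0 := by
    rw [← coeffL_apply, _root_.sum_apply, map_sum]
    have (x : ℤ) : coeffL n ((s x • (coeffL x).smulRight (fourierBasis (T := 2 * Real.pi) x) :
        L2T →L[ℂ] L2T) f) = if n = x then s x * fourierCoeff f x else 0 := by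
      change coeffL n (s x • coeffL x f • fourierBasis (T := 2 * Real.pi) x) = _
      rw [map_smul, map_smul, coeffL_apply n, fourierCoeff_fourierBasis, coeffL_apply]
      simp
    simp only [this, Finset.sum_ite_eq]
  rw [_root_.sub_apply, fourierCoeff_coe_sub, hc, fourierCoeff_fmul]
  split_ifs with hn
  · simp only [sub_self, norm_zero]
    positivity
  · rw [zero_sub, norm_neg, norm_mul]
    refine mul_le_mul_of_nonneg_right ?_ (norm_nonneg _)
    by_contra! h'
    exact hn (hF (by simpa using h'.le))

/-! ### Bounded perturbations of `∂_yy - β²` on `L²(𝕋)` -/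

/-- `r = (∂_yy - β² - i ε K) h`, as an equality of Fourier coefficients. -/
def PertRel (K : L2T →L[ℂ] L2T) (ε β : ℝ) (h r : L2T) : Prop :=
  ∀ n : ℤ, fourierCoeff r n = -((β ^ 2 + (n : ℝ) ^ 2 : ℝ) : ℂ) * fourierCoeff h n
    - Complex.I * ε * fourierCoeff (K h) n

/-- `R` is the resolvent at `μ` of the operator with graph `Rel`. -/
def IsResolventOf (Rel : L2T → L2T → Prop) (μ : ℂ) (R : L2T →L[ℂ] L2T) : Prop :=
  (∀ g, Rel (R g) (g + μ • R g)) ∧ ∀ h r, Rel h r → R (r - μ • h) = h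

/-- `G` inverts the compression of `∂_yy - β² - μ - i ε K` to the mean-free functions. -/
def IsReducedResolvent (K : L2T →L[ℂ] L2T) (ε β : ℝ) (μ : ℂ) (G : L2T →L[ℂ] L2T) : Prop :=
  ‖G‖ ≤ 4 ∧ ∀ g r : L2T, g = G r ↔ fourierCoeff g 0 = 0 ∧ ∀ n : ℤ, n ≠ 0 →
    (-((β ^ 2 + (n : ℝ) ^ 2 : ℝ) : ℂ) - μ) * fourierCoeff g n
      - Complex.I * ε * fourierCoeff (K g) n = fourierCoeff r n

theorem one_le_sq_of_ne_zero {n : ℤ} (hn : n ≠ 0) : (1 : ℝ) ≤ (n : ℝ) ^ 2 := by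
  have : (1 : ℤ) ≤ n ^ 2 := by have := sq_pos_of_ne_zero hn; omega
  exact_mod_cast this

theorem half_le_norm_symbol (β : ℝ) {μ : ℂ} (hμ : -(1 / 2) ≤ μ.re) {n : ℤ} (hn : n ≠ 0) :
    1 / 2 ≤ ‖-((β ^ 2 + (n : ℝ) ^ 2 : ℝ) : ℂ) - μ‖ := by
  have h1 := one_le_sq_of_ne_zero hn
  refine le_trans ?_ (Complex.abs_re_le_norm _)
  rw [Complex.sub_re, Complex.neg_re, Complex.ofReal_re, le_abs]
  right
  nlinarith [sq_nonneg β]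

theorem exists_isReducedResolvent {K : L2T →L[ℂ] L2T} {ε : ℝ} (β : ℝ) {μ : ℂ}
    (hK : |ε| * ‖K‖ ≤ 1 / 4) (hμ : -(1 / 2) ≤ μ.re) : ∃ G, IsReducedResolvent K ε β μ G := by
  set s : ℤ → ℂ := fun n => if n = 0 then 0 else (-((β ^ 2 + (n : ℝ) ^ 2 : ℝ) : ℂ) - μ)⁻¹ with hs
  have hs2 (n : ℤ) : ‖s n‖ ≤ 2 := by
    by_cases hn : n = 0
    · simp [hs, hn]
    · simp only [hs, hn, if_false, norm_inv]
      have := half_le_norm_symbol β hμ hn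
      calc _ ≤ (1 / 2 : ℝ)⁻¹ := inv_anti₀ (by norm_num) this
        _ = 2 := by norm_num
  set R := fmul s ⟨2, hs2⟩
  have hR : ‖R‖ ≤ 2 := norm_fmul_le _ hs2
  set t : L2T →L[ℂ] L2T := (Complex.I * ε) • (R * K) with ht
  have ht2 : ‖t‖ ≤ 1 / 2 := by
    rw [ht, norm_smul, norm_mul, Complex.norm_I, one_mul, Complex.norm_real, Real.norm_eq_abs]
    have : ‖R * K‖ ≤ 2 * ‖K‖ :=
      (norm_mul_le _ _).trans (mul_le_mul_of_nonneg_right hR (norm_nonneg _))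
    nlinarith [abs_nonneg ε]
  set u := Units.oneSub t (by linarith)
  set N : L2T →L[ℂ] L2T := ↑u⁻¹
  have hN1 : N * (1 - t) = 1 := u.inv_mul
  have hN2 : (1 - t) * N = 1 := u.mul_inv
  have hN : ‖N‖ ≤ 2 := by
    have h1 : N = 1 + t * N := by
      rw [sub_mul, one_mul, sub_eq_iff_eq_add] at hN2
      exact hN2
    have h2 : ‖N‖ ≤ 1 + 1 / 2 * ‖N‖ := by
      calc ‖N‖ = ‖1 + t * N‖ := by rw [← h1]
        _ ≤ ‖(1 : L2T →L[ℂ] L2T)‖ + ‖t * N‖ := norm_add_le _ _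
        _ ≤ 1 + 1 / 2 * ‖N‖ := add_le_add ContinuousLinearMap.norm_id_le
          ((norm_mul_le _ _).trans (mul_le_mul_of_nonneg_right ht2 (norm_nonneg _)))
    linarith
  refine ⟨N * R, ?_, fun g r => ?_⟩
  · calc ‖N * R‖ ≤ ‖N‖ * ‖R‖ := norm_mul_le _ _
      _ ≤ 2 * 2 := mul_le_mul hN hR (norm_nonneg _) (by norm_num)
      _ = 4 := by norm_num
  have h1 : g = (N * R) r ↔ (1 - t) g = R r := by
    constructor
    · rintro rfl
      exact congrArg (fun T : L2T →L[ℂ] L2T => T (R r)) hN2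
    · intro h
      have h' : N ((1 - t) g) = g := congrArg (fun T : L2T →L[ℂ] L2T => T g) hN1
      rw [← h', h]
      rfl
  have h2 : (1 - t) g = R r ↔ g = R (r + (Complex.I * ε) • K g) := by
    have h3 : (1 - t) g = g - (Complex.I * ε) • R (K g) := rfl
    rw [h3, sub_eq_iff_eq_add, map_add, map_smul]
  rw [h1, h2]
  constructor
  · intro h
    have hc (n : ℤ) : fourierCoeff g n
        = s n * (fourierCoeff r n + Complex.I * ε * fourierCoeff (K g) n) := by
      conv_lhs => rw [h]
      rw [fourierCoeff_fmul, fourierCoeff_coe_add, fourierCoeff_coe_smul]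
    refine ⟨by rw [hc]; simp [hs], fun n hn => ?_⟩
    have hne : -((β ^ 2 + (n : ℝ) ^ 2 : ℝ) : ℂ) - μ ≠ 0 := by
      rw [← norm_pos_iff]; linarith [half_le_norm_symbol β hμ hn]
    rw [hc n]
    simp only [hs, hn, if_false]
    rw [mul_inv_cancel_left₀ hne]
    ring
  · rintro ⟨h0, h⟩
    refine fourierCoeff_ext fun n => ?_
    rw [fourierCoeff_fmul, fourierCoeff_coe_add, fourierCoeff_coe_smul]
    by_cases hn : n = 0
    · simp [hs, hn, h0]
    · have hne : -((β ^ 2 + (n : ℝ) ^ 2 : ℝ) : ℂ) - μ ≠ 0 := by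
        rw [← norm_pos_iff]; linarith [half_le_norm_symbol β hμ hn]
      simp only [hs, hn, if_false]
      rw [eq_inv_mul_iff_mul_eq₀ hne, ← h n hn]
      ring

section

variable {K : L2T →L[ℂ] L2T} {ε β : ℝ} {μ : ℂ} {G : L2T →L[ℂ] L2T}

/-- The Schur complement of the compression to the mean-free functions. -/
def schur (K : L2T →L[ℂ] L2T) (ε β : ℝ) (μ : ℂ) (G : L2T →L[ℂ] L2T) : ℂ :=
  -((β ^ 2 : ℝ) : ℂ) - μ + (ε : ℂ) ^ 2 * fourierCoeff (K (G (K one))) 0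

theorem pertRel_iff (hG : IsReducedResolvent K ε β μ G) (hK0 : fourierCoeff (K one) 0 = 0)
    (h r : L2T) : PertRel K ε β h (r + μ • h) ↔
      h = fourierCoeff h 0 • one + G (r + (Complex.I * ε * fourierCoeff h 0) • K one) ∧
      schur K ε β μ G * fourierCoeff h 0
        = fourierCoeff r 0 + Complex.I * ε * fourierCoeff (K (G r)) 0 := by
  set a := fourierCoeff h 0 with ha
  set g := h - a • one with hg
  have hgh : h = a • one + g := by rw [hg]; abel
  have hg0 : fourierCoeff g 0 = 0 := by
    rw [hg, fourierCoeff_coe_sub, fourierCoeff_coe_smul, fourierCoeff_one, if_pos rfl, mul_one,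
      ← ha, sub_self]
  have hgn (n : ℤ) (hn : n ≠ 0) : fourierCoeff h n = fourierCoeff g n := by
    rw [hg, fourierCoeff_coe_sub, fourierCoeff_coe_smul, fourierCoeff_one, if_neg hn, mul_zero,
      sub_zero]
  have hKh (n : ℤ) : fourierCoeff (K h) n
      = a * fourierCoeff (K one) n + fourierCoeff (K g) n := by
    rw [hgh, map_add, map_smul, fourierCoeff_coe_add, fourierCoeff_coe_smul]
  have e1 : h = a • one + G (r + (Complex.I * ε * a) • K one) ↔
      g = G (r + (Complex.I * ε * a) • K one) := by
    rw [hg, sub_eq_iff_eq_add, add_comm]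
  have e2 : PertRel K ε β h (r + μ • h) ↔
      ((-((β ^ 2 : ℝ) : ℂ) - μ) * a - Complex.I * ε * fourierCoeff (K g) 0 = fourierCoeff r 0) ∧
      ∀ n : ℤ, n ≠ 0 → (-((β ^ 2 + (n : ℝ) ^ 2 : ℝ) : ℂ) - μ) * fourierCoeff g n
        - Complex.I * ε * fourierCoeff (K g) n
        = fourierCoeff r n + Complex.I * ε * a * fourierCoeff (K one) n := by
    have key (n : ℤ) : fourierCoeff (r + μ • h : L2T) n
          = fourierCoeff r n + μ * fourierCoeff h n := by
      rw [fourierCoeff_coe_add, fourierCoeff_coe_smul]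
    constructor
    · intro H
      refine ⟨?_, fun n hn => ?_⟩
      · have := H 0
        rw [key, hKh, hK0, ← ha] at this
        simp only [Int.cast_zero, ne_eq, OfNat.ofNat_ne_zero, not_false_eq_true, zero_pow,
          add_zero, mul_zero, zero_add] at this
        linear_combination -this
      · have := H n
        rw [key, hKh, hgn n hn] at this
        linear_combination -this
    · rintro ⟨H0, H⟩ n
      rw [key, hKh]
      by_cases hn : n = 0
      · subst hn
        rw [hK0, ← ha]
        simp only [Int.cast_zero, ne_eq, OfNat.ofNat_ne_zero, not_false_eq_true, zero_pow,
          add_zero, mul_zero, zero_add]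
        linear_combination -H0
      · rw [hgn n hn]
        linear_combination -(H n hn)
  rw [e1, e2, and_comm]
  have e3 := hG.2 g (r + (Complex.I * ε * a) • K one)
  simp only [fourierCoeff_coe_add, fourierCoeff_coe_smul] at e3
  rw [e3]
  have e4 : (∀ n : ℤ, n ≠ 0 → (-((β ^ 2 + (n : ℝ) ^ 2 : ℝ) : ℂ) - μ) * fourierCoeff g n
        - Complex.I * ε * fourierCoeff (K g) n
        = fourierCoeff r n + Complex.I * ε * a * fourierCoeff (K one) n) →
      fourierCoeff (K g) 0
        = fourierCoeff (K (G r)) 0 + Complex.I * ε * a * fourierCoeff (K (G (K one))) 0 := by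
    intro H
    rw [e3.2 ⟨hg0, H⟩, map_add, map_smul, map_add, map_smul, fourierCoeff_coe_add,
      fourierCoeff_coe_smul]
  constructor
  · rintro ⟨H, H0⟩
    refine ⟨⟨hg0, H⟩, ?_⟩
    rw [e4 H] at H0
    rw [schur]
    linear_combination H0 + ε ^ 2 * a * fourierCoeff (K (G (K one))) 0 * Complex.I_sq
  · rintro ⟨⟨-, H⟩, H0⟩
    refine ⟨H, ?_⟩
    rw [e4 H]
    rw [schur] at H0
    linear_combination H0 - ε ^ 2 * a * fourierCoeff (K (G (K one))) 0 * Complex.I_sq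

theorem exists_isResolventOf_of_schur_ne_zero (hG : IsReducedResolvent K ε β μ G)
    (hK0 : fourierCoeff (K one) 0 = 0) (hF : schur K ε β μ G ≠ 0) :
    ∃ R, IsResolventOf (PertRel K ε β) μ R := by
  set F := schur K ε β μ G
  set a : L2T →L[ℂ] ℂ := F⁻¹ • (coeffL 0 + (Complex.I * ε) • (coeffL 0 ∘L K ∘L G)) with ha
  have ha' (r : L2T) : F * a r
      = fourierCoeff r 0 + Complex.I * ε * fourierCoeff (K (G r)) 0 := by
    have : a r = F⁻¹ * (coeffL 0 r + Complex.I * ε * coeffL 0 (K (G r))) := rfl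
    rw [this, mul_inv_cancel_left₀ hF, coeffL_apply, coeffL_apply]
  set v := one + (Complex.I * ε) • G (K one) with hv
  set R : L2T →L[ℂ] L2T := G + a.smulRight v
  have hR (r : L2T) : R r = a r • one + G (r + (Complex.I * ε * a r) • K one) := by
    have : R r = G r + a r • v := rfl
    rw [this, hv, map_add, map_smul, smul_add, smul_smul, mul_comm (a r)]
    abel
  have hR0 (r : L2T) : fourierCoeff (R r) 0 = a r := by
    rw [hR, fourierCoeff_coe_add, fourierCoeff_coe_smul, fourierCoeff_one, if_pos rfl, mul_one,
      ((hG.2 _ _).1 rfl).1, add_zero]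
  refine ⟨R, fun g => ?_, fun h r H => ?_⟩
  · rw [pertRel_iff hG hK0, hR0]
    exact ⟨hR g, ha' g⟩
  · have H' : PertRel K ε β h ((r - μ • h) + μ • h) := by rwa [sub_add_cancel]
    obtain ⟨h1, h2⟩ := (pertRel_iff hG hK0 _ _).1 H'
    have h3 : a (r - μ • h) = fourierCoeff h 0 := mul_left_cancel₀ hF (by rw [ha', h2])
    rw [hR, h3]
    exact h1.symm

end

theorem IsReducedResolvent.sub {K : L2T →L[ℂ] L2T} {ε β : ℝ} {μ μ' : ℂ} {G G' : L2T →L[ℂ] L2T}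
    (hG : IsReducedResolvent K ε β μ G) (hG' : IsReducedResolvent K ε β μ' G') (r : L2T) :
    G r - G' r = (μ - μ') • G' (G r) := by
  obtain ⟨h0, h⟩ := (hG.2 (G r) r).1 rfl
  have : G r = G' (r + (μ - μ') • G r) := by
    refine (hG'.2 _ _).2 ⟨h0, fun n hn => ?_⟩
    rw [fourierCoeff_coe_add, fourierCoeff_coe_smul, ← h n hn]
    ring
  rw [map_add, map_smul] at this
  rw [sub_eq_iff_eq_add', ← this]

theorem norm_coeff_comp_le {K : L2T →L[ℂ] L2T} {κ : ℝ} (hK : ‖K‖ ≤ κ) {c : ℝ} {g : L2T}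
    (hg : ‖g‖ ≤ c) : ‖fourierCoeff (K g) 0‖ ≤ κ * c :=
  (norm_fourierCoeff_le _ 0).trans <| (K.le_opNorm g).trans <|
    mul_le_mul hK hg (norm_nonneg _) ((norm_nonneg _).trans hK)

/-- The zero of the Schur complement in the half-plane `Re μ ≥ -1/2`. -/
theorem exists_schur_eq_zero {K : L2T →L[ℂ] L2T} {ε β κ : ℝ} (hK : ‖K‖ ≤ κ)
    (hε : |ε| * κ ≤ 1 / 8) (hβ : β ^ 2 ≤ 1 / 8) :
    ∃ μ G, ‖μ‖ ≤ β ^ 2 + 4 * κ ^ 2 * ε ^ 2 ∧ IsReducedResolvent K ε β μ G ∧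
      schur K ε β μ G = 0 ∧
      ∀ μ' G', -(1 / 2) ≤ μ'.re → IsReducedResolvent K ε β μ' G' → schur K ε β μ' G' = 0 →
        μ' = μ := by
  have hκ : 0 ≤ κ := (norm_nonneg _).trans hK
  have hεK : |ε| * ‖K‖ ≤ 1 / 4 := by nlinarith [abs_nonneg ε]
  have hεκ : ε ^ 2 * κ ^ 2 ≤ 1 / 64 := by
    rw [← sq_abs, ← mul_pow]
    nlinarith [mul_nonneg (abs_nonneg ε) hκ]
  have hK1 : ‖K one‖ ≤ κ := by
    have := K.le_opNorm one
    rw [norm_one_L2T, mul_one] at this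
    exact this.trans hK
  have hb {μ G} (hG : IsReducedResolvent K ε β μ G) :
      ‖fourierCoeff (K (G (K one))) 0‖ ≤ 4 * κ ^ 2 := by
    refine (norm_coeff_comp_le hK ((G.le_opNorm _).trans
      (mul_le_mul hG.1 hK1 (norm_nonneg _) (by norm_num)))).trans (le_of_eq (by ring))
  have hlip {μ μ' G G'} (hG : IsReducedResolvent K ε β μ G)
      (hG' : IsReducedResolvent K ε β μ' G') :
      ‖fourierCoeff (K (G (K one))) 0 - fourierCoeff (K (G' (K one))) 0‖
        ≤ 16 * κ ^ 2 * ‖μ - μ'‖ := by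
    rw [← fourierCoeff_coe_sub, ← map_sub, hG.sub hG']
    refine (norm_coeff_comp_le (c := ‖μ - μ'‖ * (4 * (4 * κ))) hK ?_).trans
      (le_of_eq (by ring))
    rw [norm_smul]
    refine mul_le_mul_of_nonneg_left ?_ (norm_nonneg _)
    refine (G'.le_opNorm _).trans (mul_le_mul hG'.1 ?_ (norm_nonneg _) (by norm_num))
    exact (G.le_opNorm _).trans (mul_le_mul hG.1 hK1 (norm_nonneg _) (by norm_num))
  have hex (μ : ℂ) : ∃ G, -(1 / 2) ≤ μ.re → IsReducedResolvent K ε β μ G := by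
    by_cases h : -(1 / 2) ≤ μ.re
    · obtain ⟨G, hG⟩ := exists_isReducedResolvent β hεK h
      exact ⟨G, fun _ => hG⟩
    · exact ⟨0, fun h' => absurd h' h⟩
  choose G hG using hex
  set Φ : ℂ → ℂ := fun μ =>
    -((β ^ 2 : ℝ) : ℂ) + (ε : ℂ) ^ 2 * fourierCoeff (K (G μ (K one))) 0 with hΦ
  have hre {μ : ℂ} (h : ‖μ‖ ≤ 1 / 4) : -(1 / 2) ≤ μ.re := by
    have := (abs_le.1 (Complex.abs_re_le_norm μ)).1
    linarith
  have hεn : ‖(ε : ℂ) ^ 2‖ = ε ^ 2 := by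
    rw [norm_pow, Complex.norm_real, Real.norm_eq_abs, sq_abs]
  have hbound {x : ℂ} (hx : ‖x‖ ≤ 4 * κ ^ 2) :
      ‖-((β ^ 2 : ℝ) : ℂ) + (ε : ℂ) ^ 2 * x‖ ≤ β ^ 2 + 4 * κ ^ 2 * ε ^ 2 := by
    refine (norm_add_le _ _).trans ?_
    rw [norm_neg, Complex.norm_real, norm_mul, hεn, Real.norm_of_nonneg (sq_nonneg β)]
    nlinarith [sq_nonneg ε]
  have hmaps : Set.MapsTo Φ (Metric.closedBall 0 (1 / 4)) (Metric.closedBall 0 (1 / 4)) := by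
    intro μ hμ
    rw [mem_closedBall_zero_iff] at hμ ⊢
    refine (hbound (hb (hG μ (hre hμ)))).trans ?_
    linarith
  have hcontr : ContractingWith (1 / 4) (hmaps.restrict Φ _ _) := by
    refine ⟨by rw [← NNReal.coe_lt_coe]; norm_num, LipschitzWith.of_dist_le_mul fun μ μ' => ?_⟩
    have h1 := hre (mem_closedBall_zero_iff.1 μ.2)
    have h2 := hre (mem_closedBall_zero_iff.1 μ'.2)
    rw [Subtype.dist_eq, Subtype.dist_eq, dist_eq_norm, dist_eq_norm]
    simp only [Set.MapsTo.val_restrict_apply, hΦ]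
    rw [add_sub_add_left_eq_sub, ← mul_sub, norm_mul, hεn]
    have := hlip (hG μ h1) (hG μ' h2)
    calc _ ≤ ε ^ 2 * (16 * κ ^ 2 * ‖(μ : ℂ) - μ'‖) := by gcongr
      _ = 16 * (ε ^ 2 * κ ^ 2) * ‖(μ : ℂ) - μ'‖ := by ring
      _ ≤ 16 * (1 / 64) * ‖(μ : ℂ) - μ'‖ := by gcongr
      _ = _ := by push_cast; ring
  obtain ⟨μ, hμ, hfix, -⟩ := hcontr.exists_fixedPoint' (Metric.isClosed_closedBall.isComplete)
    hmaps (x := 0) (by simp) (edist_ne_top _ _)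
  rw [mem_closedBall_zero_iff] at hμ
  have hGμ := hG μ (hre hμ)
  have hfix' : Φ μ = μ := hfix
  refine ⟨μ, G μ, ?_, hGμ, ?_, fun μ' G' hμ' hG' h' => ?_⟩
  · rw [← hfix']
    exact hbound (hb hGμ)
  · rw [schur]
    linear_combination hfix'
  · have h1 : μ' - μ = (ε : ℂ) ^ 2 *
        (fourierCoeff (K (G' (K one))) 0 - fourierCoeff (K (G μ (K one))) 0) := by
      rw [schur] at h'
      linear_combination -h' + hfix'
    have h2 : ‖μ' - μ‖ ≤ 1 / 4 * ‖μ' - μ‖ := by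
      conv_lhs => rw [h1, norm_mul, hεn]
      calc _ ≤ ε ^ 2 * (16 * κ ^ 2 * ‖μ' - μ‖) := by gcongr; exact hlip hG' hGμ
        _ = 16 * (ε ^ 2 * κ ^ 2) * ‖μ' - μ‖ := by ring
        _ ≤ 16 * (1 / 64) * ‖μ' - μ‖ := by gcongr
        _ = _ := by ring
    rw [← sub_eq_zero, ← norm_eq_zero]
    linarith [norm_nonneg (μ' - μ)]

/-- The resolvent at `1` is compact. -/
theorem IsResolventOf.isCompactOperator {K : L2T →L[ℂ] L2T} {ε β : ℝ} {R : L2T →L[ℂ] L2T}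
    (hR : IsResolventOf (PertRel K ε β) 1 R) : IsCompactOperator R := by
  set d : ℤ → ℝ := fun n => β ^ 2 + (n : ℝ) ^ 2 + 1 with hd
  have hd1 (n : ℤ) : 1 ≤ d n := by
    simp only [hd]; nlinarith [sq_nonneg β, sq_nonneg (n : ℝ)]
  set s : ℤ → ℂ := fun n => ((-(d n)⁻¹ : ℝ) : ℂ) with hs
  have hsn (n : ℤ) : ‖s n‖ ≤ 1 := by
    simp only [hs, Complex.norm_real, norm_neg, norm_inv, Real.norm_of_nonneg
      (zero_le_one.trans (hd1 n))]
    exact inv_le_one_of_one_le₀ (hd1 n)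
  have htend : Filter.Tendsto s Filter.cofinite (nhds 0) := by
    have h1 : Filter.Tendsto (fun n : ℤ => ((n : ℝ) ^ 2)) Filter.cofinite Filter.atTop := by
      have := (Filter.tendsto_pow_atTop (α := ℝ) two_ne_zero).comp
        (tendsto_norm_cocompact_atTop.comp Int.tendsto_coe_cofinite)
      refine this.congr fun n => ?_
      simp
    have h2 : Filter.Tendsto d Filter.cofinite Filter.atTop :=
      Filter.tendsto_atTop_mono (fun n => by simp only [hd]; nlinarith [sq_nonneg β]) h1
    have h3 := h2.inv_tendsto_atTop.neg
    rw [neg_zero] at h3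
    have h4 := (Complex.continuous_ofReal.tendsto (0 : ℝ)).comp h3
    rw [Complex.ofReal_zero] at h4
    exact h4
  have hcomp := (isCompactOperator_fmul ⟨1, hsn⟩ htend).comp_clm
    (1 + (Complex.I * ε) • (K ∘L R))
  refine (congrArg IsCompactOperator (funext fun g => ?_)).mp hcomp
  refine fourierCoeff_ext fun n => ?_
  have h1 := hR.1 g n
  have hval : (1 + (Complex.I * ε) • (K ∘L R) : L2T →L[ℂ] L2T) g
      = g + (Complex.I * ε) • K (R g) := rfl
  rw [Function.comp_apply, hval, fourierCoeff_fmul, fourierCoeff_coe_add, fourierCoeff_coe_smul]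
  rw [fourierCoeff_coe_add, fourierCoeff_coe_smul] at h1
  have hne : (d n : ℂ) ≠ 0 := by
    have := hd1 n
    exact_mod_cast (by linarith : (d n) ≠ 0)
  simp only [hs]
  push_cast
  rw [neg_mul, neg_eq_iff_eq_neg, inv_mul_eq_iff_eq_mul₀ hne]
  simp only [hd] at h1 ⊢
  push_cast at h1 ⊢
  linear_combination h1

theorem PertRel.smul {K : L2T →L[ℂ] L2T} {ε β : ℝ} {h r : L2T} (H : PertRel K ε β h r) (c : ℂ) :
    PertRel K ε β (c • h) (c • r) := fun n => by
  rw [map_smul, fourierCoeff_coe_smul, fourierCoeff_coe_smul, fourierCoeff_coe_smul, H n]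
  ring

/-- A point which is not an eigenvalue is in the resolvent set. -/
theorem exists_isResolventOf_of_injective {K : L2T →L[ℂ] L2T} {ε β : ℝ} {R : L2T →L[ℂ] L2T}
    (hR : IsResolventOf (PertRel K ε β) 1 R) {μ : ℂ}
    (hμ : ∀ h, PertRel K ε β h (μ • h) → h = 0) : ∃ R', IsResolventOf (PertRel K ε β) μ R' := by
  by_cases h1 : μ = 1
  · exact ⟨R, h1 ▸ hR⟩
  have hne : μ - 1 ≠ 0 := sub_ne_zero.2 h1
  rcases hR.isCompactOperator.hasEigenvalue_or_mem_resolventSet (inv_ne_zero hne) with h | h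
  · obtain ⟨v, hv⟩ := h.exists_hasEigenvector
    have hv1 : R v = (μ - 1)⁻¹ • v := hv.apply_eq_smul
    refine absurd (hμ v ?_) hv.2
    have := (hR.1 v).smul (μ - 1)
    rw [hv1, smul_smul, mul_inv_cancel₀ hne, one_smul, one_smul, smul_add, smul_smul,
      mul_inv_cancel₀ hne, ← add_smul, sub_add_cancel] at this
    exact this
  · rw [spectrum.mem_resolventSet_iff] at h
    obtain ⟨u, hu⟩ := h
    set N : L2T →L[ℂ] L2T := ↑u⁻¹
    have hu' : (u : L2T →L[ℂ] L2T) = (μ - 1)⁻¹ • 1 - R := by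
      rw [hu, Algebra.algebraMap_eq_smul_one]
    have hN1 (x : L2T) : N ((μ - 1)⁻¹ • x - R x) = x := by
      have := congrArg (fun T : L2T →L[ℂ] L2T => T x) u.inv_mul
      rw [hu'] at this
      exact this
    have hN2 (x : L2T) : (μ - 1)⁻¹ • N x - R (N x) = x := by
      have := congrArg (fun T : L2T →L[ℂ] L2T => T x) u.mul_inv
      rw [hu'] at this
      exact this
    have hNR (x : L2T) : N (R x) = R (N x) := by
      conv_lhs => rw [← hN2 x]
      rw [map_sub, map_smul]
      exact hN1 (R (N x))
    refine ⟨(μ - 1)⁻¹ • (R ∘L N), fun g => ?_, fun h r H => ?_⟩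
    · change PertRel K ε β ((μ - 1)⁻¹ • R (N g)) (g + μ • (μ - 1)⁻¹ • R (N g))
      convert (hR.1 (N g)).smul (μ - 1)⁻¹ using 1
      have h3 : μ * (μ - 1)⁻¹ = 1 + (μ - 1)⁻¹ := by field_simp; ring
      have h4 := hN2 g
      rw [sub_eq_iff_eq_add] at h4
      rw [smul_smul, h3, smul_add, h4, add_smul, one_smul, add_assoc]
    · change (μ - 1)⁻¹ • R (N (r - μ • h)) = h
      have h5 : r - μ • h = (r - (1 : ℂ) • h) - (μ - 1) • h := by
        rw [sub_smul]; abel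
      have h6 : R (r - μ • h) = (μ - 1) • ((μ - 1)⁻¹ • h - R h) := by
        rw [h5, map_sub, hR.2 h r H, map_smul, smul_sub, smul_smul, mul_inv_cancel₀ hne, one_smul]
      rw [← hNR, h6, map_smul, hN1, smul_smul, inv_mul_cancel₀ hne, one_smul]

/-- In the half-plane `Re μ > -1/2` the spectrum of `∂_yy - β² - i ε K` consists of a single,
algebraically simple, eigenvalue; the rest of the spectrum consists of eigenvalues. -/
theorem exists_simple_eigenvalue {K : L2T →L[ℂ] L2T} {ε β κ : ℝ} (hK : ‖K‖ ≤ κ)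
    (hε : |ε| * κ ≤ 1 / 8) (hβ : β ^ 2 ≤ 1 / 8) (hK0 : fourierCoeff (K one) 0 = 0) :
    ∃ μ G, ‖μ‖ ≤ β ^ 2 + 4 * κ ^ 2 * ε ^ 2 ∧ IsReducedResolvent K ε β μ G ∧
      schur K ε β μ G = 0 ∧
      (∀ h, PertRel K ε β h (μ • h) ↔
        h = fourierCoeff h 0 • (one + (Complex.I * ε) • G (K one))) ∧
      (∀ (h : L2T) (c : ℂ),
        PertRel K ε β h (c • (one + (Complex.I * ε) • G (K one)) + μ • h) → c = 0) ∧
      ∀ μ', (¬ ∃ R, IsResolventOf (PertRel K ε β) μ' R) → μ' ≠ μ →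
        μ'.re ≤ -(1 / 2) ∧ ∃ h, h ≠ 0 ∧ PertRel K ε β h (μ' • h) := by
  obtain ⟨μ, G, hμ, hG, hF, huniq⟩ := exists_schur_eq_zero hK hε hβ
  have hκ : 0 ≤ κ := (norm_nonneg _).trans hK
  have hεK : |ε| * ‖K‖ ≤ 1 / 4 := by nlinarith [abs_nonneg ε]
  have hεκ : κ ^ 2 * ε ^ 2 ≤ 1 / 64 := by
    rw [← sq_abs ε, ← mul_pow, mul_comm]
    nlinarith [mul_nonneg (abs_nonneg ε) hκ]
  have hres {μ' : ℂ} (h : -(1 / 2) ≤ μ'.re) (hne : μ' ≠ μ) :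
      ∃ R, IsResolventOf (PertRel K ε β) μ' R := by
    obtain ⟨G', hG'⟩ := exists_isReducedResolvent β hεK h
    exact exists_isResolventOf_of_schur_ne_zero hG' hK0 fun h0 => hne (huniq μ' G' h hG' h0)
  obtain ⟨R, hR⟩ := hres (μ' := 1) (by norm_num) (by
    rintro rfl
    rw [norm_one] at hμ
    linarith)
  set v := one + (Complex.I * ε) • G (K one) with hv
  refine ⟨μ, G, hμ, hG, hF, fun h => ?_, fun h c H => ?_, fun μ' hμ' hne => ⟨?_, ?_⟩⟩
  · have := pertRel_iff hG hK0 h 0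
    rw [zero_add, zero_add, hF] at this
    rw [this, zero_mul, map_zero, map_zero, fourierCoeff_coe_zero, mul_zero, add_zero, map_smul,
      smul_add, smul_smul, mul_comm (fourierCoeff h 0) (Complex.I * ε)]
    simp
  · rw [← hv] at H
    obtain ⟨-, h2⟩ := (pertRel_iff hG hK0 _ _).1 H
    have hv0 : fourierCoeff v 0 = 1 := by
      rw [hv, fourierCoeff_coe_add, fourierCoeff_coe_smul, fourierCoeff_one, if_pos rfl,
        ((hG.2 _ _).1 rfl).1, mul_zero, add_zero]
    rw [hF, zero_mul, map_smul, map_smul, fourierCoeff_coe_smul, fourierCoeff_coe_smul, hv0] at h2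
    have hε1 : ‖Complex.I * (ε : ℂ)‖ = |ε| := by
      rw [norm_mul, Complex.norm_I, one_mul, Complex.norm_real, Real.norm_eq_abs]
    have hGn (x : L2T) : ‖G x‖ ≤ 4 * ‖x‖ :=
      (G.le_opNorm x).trans (mul_le_mul_of_nonneg_right hG.1 (norm_nonneg _))
    have hvn : ‖v‖ ≤ 3 / 2 := by
      refine (norm_add_le _ _).trans ?_
      rw [norm_one_L2T, norm_smul, hε1]
      have h1 := hGn (K one)
      have h2 := K.le_opNorm one
      rw [norm_one_L2T, mul_one] at h2
      have h3 : ‖G (K one)‖ ≤ 4 * κ := by linarith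
      nlinarith [abs_nonneg ε]
    have hx : ‖Complex.I * ε * fourierCoeff (K (G v)) 0‖ ≤ 3 / 4 := by
      rw [norm_mul, hε1]
      have := norm_coeff_comp_le hK ((hGn v).trans (mul_le_mul_of_nonneg_left hvn (by norm_num)))
      nlinarith [abs_nonneg ε]
    have h3 : c * (1 + Complex.I * ε * fourierCoeff (K (G v)) 0) = 0 := by
      linear_combination -h2
    refine (mul_eq_zero.1 h3).resolve_right fun h0 => ?_
    have h4 : Complex.I * ε * fourierCoeff (K (G v)) 0 = -1 := by linear_combination h0
    rw [h4, norm_neg, norm_one] at hx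
    norm_num at hx
  · by_contra! h
    exact hμ' (hres h.le hne)
  · by_contra! h
    exact hμ' (exists_isResolventOf_of_injective hR fun x hx => by_contra fun h0 => h x h0 hx)

/-! ### Multiplication operators on `L²(𝕋)` -/

/-- Multiplication by an essentially bounded function `W`. -/
def mulOp (W : L2T) (hW : MemLp W ⊤ tmeas) : L2T →L[ℂ] L2T :=
  (ContinuousLinearMap.mul ℂ ℂ).holderL tmeas ⊤ 2 2 (hW.toLp W)

theorem coeFn_mulOp (W : L2T) (hW : MemLp W ⊤ tmeas) (f : L2T) :
    mulOp W hW f =ᵐ[tmeas] fun y => W y * f y := by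
  have h := ContinuousLinearMap.coeFn_holder (r := 2) (ContinuousLinearMap.mul ℂ ℂ) (hW.toLp W) f
  filter_upwards [h, hW.coeFn_toLp] with y h1 h2
  change ((ContinuousLinearMap.mul ℂ ℂ).holder 2 (hW.toLp W) f) y = _
  rw [h1, h2]
  rfl

theorem norm_mulOp_le {W : L2T} (hW : MemLp W ⊤ tmeas) {c : ℝ} (hc : 0 ≤ c)
    (h : ∀ᵐ y ∂tmeas, ‖W y‖ ≤ c) : ‖mulOp W hW‖ ≤ c := by
  refine ContinuousLinearMap.opNorm_le_bound _ hc fun f => ?_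
  refine Lp.norm_le_mul_norm_of_ae_le_mul ?_
  filter_upwards [coeFn_mulOp W hW f, h] with y h1 h2
  rw [h1, norm_mul]
  exact mul_le_mul_of_nonneg_right h2 (norm_nonneg _)

theorem ae_norm_le_of_summable {W : L2T} (h : Summable fun n => ‖fourierCoeff W n‖) :
    ∀ᵐ y ∂tmeas, ‖W y‖ ≤ ∑' n, ‖fourierCoeff W n‖ := by
  have hn (n : ℤ) : ‖fourierCoeff W n • (fourier n : C(Torus, ℂ))‖ = ‖fourierCoeff W n‖ := by
    rw [norm_smul, fourier_norm, mul_one]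
  have hs : Summable fun n => fourierCoeff W n • (fourier n : C(Torus, ℂ)) := by
    refine Summable.of_norm ?_
    simpa only [hn] using h
  set F : C(Torus, ℂ) := ∑' n, fourierCoeff W n • fourier n
  have h1 := (ContinuousMap.toLp (E := ℂ) 2 tmeas ℂ).hasSum hs.hasSum
  have h2 : HasSum (fun n => fourierCoeff W n • fourierLp 2 n) W := hasSum_fourier_series_L2 W
  have h3 : ContinuousMap.toLp (E := ℂ) 2 tmeas ℂ F = W := by
    refine h1.unique ?_
    convert h2 using 2 with n
    simp only [map_smul]
  have h4 : ‖F‖ ≤ ∑' n, ‖fourierCoeff W n‖ := by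
    have := norm_tsum_le_tsum_norm (f := fun n => fourierCoeff W n • (fourier n : C(Torus, ℂ)))
      (by simpa only [hn] using h)
    simpa only [hn] using this
  have h5 := ContinuousMap.coeFn_toLp (p := 2) (𝕜 := ℂ) tmeas F
  rw [h3] at h5
  filter_upwards [h5] with y hy
  rw [hy]
  exact (F.norm_coe_le_norm y).trans h4

theorem fourierCoeff_star (W : L2T) (n : ℤ) :
    fourierCoeff (star W : L2T) n = star (fourierCoeff W (-n)) := by
  rw [fourierCoeff_congr_ae (Lp.coeFn_star W), fourierCoeff, fourierCoeff]
  rw [← starRingEnd_apply (R := ℂ), ← integral_conj]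
  refine integral_congr_ae (Filter.Eventually.of_forall fun y => ?_)
  simp

theorem fourierCoeff_neg_of_real {U : L2T} (hU : ∀ᵐ y ∂tmeas, (U y).im = 0) (n : ℤ) :
    fourierCoeff U (-n) = star (fourierCoeff U n) := by
  have h : star U = U := by
    refine Lp.ext ?_
    filter_upwards [Lp.coeFn_star U, hU] with y h1 h2
    rw [h1]
    exact Complex.conj_eq_iff_im.2 h2
  conv_lhs => rw [← h]
  rw [fourierCoeff_star, neg_neg]

theorem hasSum_fourierCoeff_mulOp_zero (W : L2T) (hW : MemLp W ⊤ tmeas) (f : L2T) :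
    HasSum (fun n => fourierCoeff W (-n) * fourierCoeff f n) (fourierCoeff (mulOp W hW f) 0) := by
  have h := (fourierBasis (T := 2 * Real.pi)).hasSum_inner_mul_inner (star W) f
  have h1 : inner ℂ (star W) f = fourierCoeff (mulOp W hW f) 0 := by
    rw [L2.inner_def, fourierCoeff]
    refine integral_congr_ae ?_
    filter_upwards [Lp.coeFn_star W, coeFn_mulOp W hW f] with y h1 h2
    rw [h1, h2]
    simp [mul_comm]
  rw [h1] at h
  refine h.congr_fun fun n => ?_
  rw [← HilbertBasis.repr_apply_apply, fourierBasis_repr, ← inner_conj_symm,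
    ← HilbertBasis.repr_apply_apply, fourierBasis_repr, fourierCoeff_star, starRingEnd_apply,
    star_star]

theorem fourierCoeff_zero_eq_integral (U : L2T) : fourierCoeff U 0 = ∫ y, U y ∂tmeas := by
  simp [fourierCoeff]

/-! ### The conjugated transport operator -/

/-- The projection onto the mean-free functions. -/
def meanFree : L2T →L[ℂ] L2T :=
  fmul (fun n => if n = 0 then 0 else 1) ⟨1, fun n => by split_ifs <;> simp⟩

theorem fourierCoeff_meanFree (f : L2T) (n : ℤ) :
    fourierCoeff (meanFree f) n = if n = 0 then 0 else fourierCoeff f n := by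
  rw [meanFree, fourierCoeff_fmul]
  split_ifs <;> simp

theorem norm_meanFree_le : ‖meanFree‖ ≤ 1 := norm_fmul_le _ fun n => by split_ifs <;> simp

theorem norm_streamSymbol_le (β : ℝ) (n : ℤ) :
    ‖(if n = 0 then 0 else -((β ^ 2 + (n : ℝ) ^ 2 : ℝ) : ℂ)⁻¹ : ℂ)‖ ≤ 1 := by
  split_ifs with hn
  · simp
  · rw [norm_neg, norm_inv, Complex.norm_real, Real.norm_of_nonneg (by positivity)]
    exact inv_le_one_of_one_le₀ (by nlinarith [sq_nonneg β, one_le_sq_of_ne_zero hn])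

/-- The inverse of `∂_yy - β²` on the mean-free functions. -/
def stream (β : ℝ) : L2T →L[ℂ] L2T :=
  fmul (fun n => if n = 0 then 0 else -((β ^ 2 + (n : ℝ) ^ 2 : ℝ) : ℂ)⁻¹)
    ⟨1, norm_streamSymbol_le β⟩

theorem fourierCoeff_stream (β : ℝ) (f : L2T) (n : ℤ) : fourierCoeff (stream β f) n
    = if n = 0 then 0 else -((β ^ 2 + (n : ℝ) ^ 2 : ℝ) : ℂ)⁻¹ * fourierCoeff f n := by
  rw [stream, fourierCoeff_fmul]
  split_ifs <;> simp

theorem norm_stream_le (β : ℝ) : ‖stream β‖ ≤ 1 := norm_fmul_le _ (norm_streamSymbol_le β)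

theorem meanFree_one : meanFree one = 0 := fourierCoeff_ext fun n => by
  rw [fourierCoeff_meanFree, fourierCoeff_one, fourierCoeff_coe_zero]
  split_ifs <;> rfl

theorem stream_one (β : ℝ) : stream β one = 0 := fourierCoeff_ext fun n => by
  rw [fourierCoeff_stream, fourierCoeff_one, fourierCoeff_coe_zero]
  split_ifs <;> simp

section

variable {U W : L2T} (hU : MemLp U ⊤ tmeas) (hW : MemLp W ⊤ tmeas) (β : ℝ)

/-- The operator `f ↦ U f - W (∂_yy - β²)⁻¹ f`, conjugated by the multiplication of the mean by
`-β²`. -/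
def transportOp : L2T →L[ℂ] L2T :=
  meanFree ∘L (mulOp U hU ∘L meanFree - mulOp W hW ∘L stream β)
    - (coeffL 0).smulRight (((β ^ 2 : ℝ) : ℂ) • U + W)
    + (coeffL 0 ∘L mulOp U hU ∘L stream β).smulRight one

theorem transportOp_apply (h : L2T) : transportOp hU hW β h
    = meanFree (mulOp U hU (meanFree h) - mulOp W hW (stream β h))
      - fourierCoeff h 0 • (((β ^ 2 : ℝ) : ℂ) • U + W)
      + fourierCoeff (mulOp U hU (stream β h)) 0 • one := by
  rw [← coeffL_apply, ← coeffL_apply]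
  rfl

theorem transportOp_one : transportOp hU hW β one = -(((β ^ 2 : ℝ) : ℂ) • U + W) := by
  rw [transportOp_apply, meanFree_one, stream_one, map_zero, map_zero, sub_zero, map_zero,
    fourierCoeff_coe_zero, fourierCoeff_one, if_pos rfl, one_smul, zero_smul, zero_sub, add_zero]

theorem fourierCoeff_transportOp_zero (hU0 : fourierCoeff U 0 = 0) (hW0 : fourierCoeff W 0 = 0)
    (h : L2T) : fourierCoeff (transportOp hU hW β h) 0
      = fourierCoeff (mulOp U hU (stream β h)) 0 := by
  rw [transportOp_apply, fourierCoeff_coe_add, fourierCoeff_coe_sub, fourierCoeff_meanFree,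
    if_pos rfl, fourierCoeff_coe_smul, fourierCoeff_coe_smul, fourierCoeff_coe_add,
    fourierCoeff_coe_smul, hU0, hW0, fourierCoeff_one, if_pos rfl]
  ring

theorem fourierCoeff_transportOp (n : ℤ) (hn : n ≠ 0)
    (h : L2T) : fourierCoeff (transportOp hU hW β h) n
      = fourierCoeff (mulOp U hU (meanFree h)) n - fourierCoeff (mulOp W hW (stream β h)) n
        - fourierCoeff h 0 * (((β ^ 2 : ℝ) : ℂ) * fourierCoeff U n + fourierCoeff W n) := by
  rw [transportOp_apply, fourierCoeff_coe_add, fourierCoeff_coe_sub, fourierCoeff_meanFree,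
    if_neg hn, fourierCoeff_coe_smul, fourierCoeff_coe_smul, fourierCoeff_coe_add,
    fourierCoeff_coe_smul, fourierCoeff_one, if_neg hn, fourierCoeff_coe_sub]
  ring

theorem norm_transportOp_le {w M : ℝ} (hUw : ‖mulOp U hU‖ ≤ w) (hWw : ‖mulOp W hW‖ ≤ w)
    (hUM : ‖U‖ ≤ M) (hWM : ‖W‖ ≤ M) (hβ : β ^ 2 ≤ 1) :
    ‖transportOp hU hW β‖ ≤ 3 * w + 2 * M := by
  have hw : 0 ≤ w := (norm_nonneg _).trans hUw
  have hM : 0 ≤ M := (norm_nonneg _).trans hUM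
  refine ContinuousLinearMap.opNorm_le_bound _ (by positivity) fun h => ?_
  have e1 (f : L2T) : ‖meanFree f‖ ≤ ‖f‖ := by
    simpa using meanFree.le_of_opNorm_le norm_meanFree_le f
  have e2 (f : L2T) : ‖stream β f‖ ≤ ‖f‖ := by
    simpa using (stream β).le_of_opNorm_le (norm_stream_le β) f
  have e3 : ‖mulOp U hU (meanFree h)‖ ≤ w * ‖h‖ :=
    ((mulOp U hU).le_of_opNorm_le hUw _).trans (mul_le_mul_of_nonneg_left (e1 h) hw)
  have e4 : ‖mulOp W hW (stream β h)‖ ≤ w * ‖h‖ :=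
    ((mulOp W hW).le_of_opNorm_le hWw _).trans (mul_le_mul_of_nonneg_left (e2 h) hw)
  have e5 : ‖mulOp U hU (stream β h)‖ ≤ w * ‖h‖ :=
    ((mulOp U hU).le_of_opNorm_le hUw _).trans (mul_le_mul_of_nonneg_left (e2 h) hw)
  have e6 : ‖((β ^ 2 : ℝ) : ℂ) • U + W‖ ≤ 2 * M := by
    refine (norm_add_le _ _).trans ?_
    rw [norm_smul, Complex.norm_real, Real.norm_of_nonneg (sq_nonneg β)]
    nlinarith [norm_nonneg U]
  rw [transportOp_apply]
  refine (norm_add_le _ _).trans ?_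
  refine (add_le_add_left (norm_sub_le _ _) _).trans ?_
  rw [norm_smul, norm_smul, norm_one_L2T, mul_one]
  have e7 := (e1 (mulOp U hU (meanFree h) - mulOp W hW (stream β h))).trans (norm_sub_le _ _)
  have e8 := mul_le_mul (norm_fourierCoeff_le h 0) e6 (norm_nonneg _) (norm_nonneg _)
  have e9 := norm_fourierCoeff_le (mulOp U hU (stream β h)) 0
  linarith

/-- For `W = U''` the mean of `U (∂_yy ψ - β² ψ) - U'' ψ` is that of `-β² U ψ`. -/
theorem fourierCoeff_transport_zero 
    (hUW : ∀ n : ℤ, fourierCoeff W n = -((n : ℂ) ^ 2) * fourierCoeff U n)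
    (h : L2T) :
    fourierCoeff (mulOp U hU (meanFree h)) 0 - fourierCoeff (mulOp W hW (stream β h)) 0
      = -((β ^ 2 : ℝ) : ℂ) * fourierCoeff (mulOp U hU (stream β h)) 0 := by
  have h1 := (hasSum_fourierCoeff_mulOp_zero U hU (meanFree h)).sub
    (hasSum_fourierCoeff_mulOp_zero W hW (stream β h))
  have h2 := (hasSum_fourierCoeff_mulOp_zero U hU (stream β h)).mul_left (-((β ^ 2 : ℝ) : ℂ))
  refine h1.unique ?_
  refine h2.congr_fun fun n => ?_
  rw [fourierCoeff_meanFree, fourierCoeff_stream, hUW]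
  by_cases hn : n = 0
  · simp [hn]
  · rw [if_neg hn, if_neg hn]
    have hne : ((β ^ 2 + (n : ℝ) ^ 2 : ℝ) : ℂ) ≠ 0 := by
      have := one_le_sq_of_ne_zero hn
      have h0 : β ^ 2 + (n : ℝ) ^ 2 ≠ 0 := by nlinarith [sq_nonneg β]
      exact_mod_cast h0
    field_simp
    push_cast
    ring

end

/-! ### Bounds in terms of the `H³` norm -/

theorem hasSum_normH {s : ℕ} {U : L2T} (hU : MemH s U) :
    HasSum (fun n : ℤ => (1 + (n : ℝ) ^ 2) ^ s * ‖fourierCoeff U n‖ ^ 2) (normH s U ^ 2) := by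
  rw [normH, Real.sq_sqrt (tsum_nonneg fun n => by positivity)]
  exact hU.hasSum

theorem normH_nonneg (s : ℕ) (U : L2T) : 0 ≤ normH s U := Real.sqrt_nonneg _

theorem norm_le_normH {s : ℕ} {U : L2T} (hU : MemH s U) : ‖U‖ ≤ normH s U := by
  refine le_of_sq_le_sq (hasSum_le (fun n => ?_) (hasSum_norm_sq U) (hasSum_normH hU))
    (normH_nonneg _ _)
  exact le_mul_of_one_le_left (by positivity) (one_le_pow₀ (by nlinarith [sq_nonneg (n : ℝ)]))

theorem norm_deriv2_coeff_sq_le (U : L2T) (n : ℤ) :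
    ‖-((n : ℂ) ^ 2) * fourierCoeff U n‖ ^ 2
      ≤ (1 + (n : ℝ) ^ 2) ^ 3 * ‖fourierCoeff U n‖ ^ 2 := by
  rw [norm_mul, norm_neg, norm_pow, Complex.norm_intCast, sq_abs, mul_pow]
  refine mul_le_mul_of_nonneg_right ?_ (by positivity)
  have h := sq_nonneg (n : ℝ)
  calc ((n : ℝ) ^ 2) ^ 2 ≤ (1 + (n : ℝ) ^ 2) ^ 2 := by gcongr; linarith
    _ ≤ (1 + (n : ℝ) ^ 2) ^ 3 := pow_le_pow_right₀ (by linarith) (by norm_num)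

theorem fourierCoeff_deriv2 {U : L2T} (hU : MemH 3 U) (n : ℤ) :
    fourierCoeff (deriv2 U) n = -((n : ℂ) ^ 2) * fourierCoeff U n := by
  rw [deriv2, fourierCoeff_ofCoeff]
  refine memℓp_gen ?_
  simp only [ENNReal.toReal_ofNat, Real.rpow_ofNat]
  exact Summable.of_nonneg_of_le (fun n => by positivity) (norm_deriv2_coeff_sq_le U) hU

theorem norm_deriv2_le {U : L2T} (hU : MemH 3 U) : ‖deriv2 U‖ ≤ normH 3 U := by
  refine le_of_sq_le_sq (hasSum_le (fun n => ?_) (hasSum_norm_sq _) (hasSum_normH hU))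
    (normH_nonneg _ _)
  rw [fourierCoeff_deriv2 hU]
  exact norm_deriv2_coeff_sq_le U n

theorem fourierCoeff_antideriv (U : L2T) (n : ℤ) : fourierCoeff (antideriv U) n
    = if n = 0 then 0 else fourierCoeff U n / (Complex.I * (n : ℂ)) := by
  rw [antideriv, fourierCoeff_ofCoeff]
  have h := memℓp_mul (s := fun n => if n = 0 then 0 else (Complex.I * (n : ℂ))⁻¹) (c := 1)
    (fun n => ?_) (memℓp_fourierCoeff U)
  · refine (congrArg (Memℓp · 2) (funext fun n => ?_)).mp h
    split_ifs
    · simp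
    · rw [div_eq_inv_mul]
  · split_ifs with hn
    · simp
    · rw [norm_inv, norm_mul, Complex.norm_I, one_mul, Complex.norm_intCast]
      exact inv_le_one_of_one_le₀ (by exact_mod_cast Int.one_le_abs hn)

theorem norm_antideriv_le (U : L2T) : ‖antideriv U‖ ≤ ‖U‖ := by
  have := norm_le_of_fourierCoeff_le (f := antideriv U) (g := U) zero_le_one fun n => ?_
  · simpa using this
  · rw [fourierCoeff_antideriv, one_mul]
    split_ifs with hn
    · simp
    · rw [norm_div, norm_mul, Complex.norm_I, one_mul, Complex.norm_intCast]
      exact div_le_self (norm_nonneg _) (by exact_mod_cast Int.one_le_abs hn)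

theorem summable_inv_one_add_sq : Summable fun n : ℤ => (1 + (n : ℝ) ^ 2)⁻¹ := by
  refine Summable.of_norm_bounded_eventually (Real.summable_one_div_int_pow.2 one_lt_two) ?_
  filter_upwards [(Set.finite_singleton (0 : ℤ)).compl_mem_cofinite] with n hn
  have h1 := one_le_sq_of_ne_zero (n := n) (by simpa using hn)
  rw [Real.norm_of_nonneg (by positivity), one_div]
  exact inv_anti₀ (by linarith) (by linarith)

/-- A bound for the Wiener norms of `U` and `U''` in terms of a bound for the `H³` norm of `U`. -/
def wienerBound (M : ℝ) : ℝ := (∑' n : ℤ, (1 + (n : ℝ) ^ 2)⁻¹ + M ^ 2) / 2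

theorem wienerBound_nonneg (M : ℝ) : 0 ≤ wienerBound M := by
  have : 0 ≤ ∑' n : ℤ, (1 + (n : ℝ) ^ 2)⁻¹ := tsum_nonneg fun n => by positivity
  unfold wienerBound
  positivity

theorem ae_norm_le_wienerBound {U W : L2T} {M : ℝ} (hU : MemH 3 U) (hM : normH 3 U ≤ M)
    (hW : ∀ n : ℤ, ‖fourierCoeff W n‖ ≤ (1 + (n : ℝ) ^ 2) * ‖fourierCoeff U n‖) :
    ∀ᵐ y ∂tmeas, ‖W y‖ ≤ wienerBound M := by
  have h1 (n : ℤ) : ‖fourierCoeff W n‖ ≤ ((1 + (n : ℝ) ^ 2)⁻¹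
      + (1 + (n : ℝ) ^ 2) ^ 3 * ‖fourierCoeff U n‖ ^ 2) / 2 := by
    refine (hW n).trans ?_
    set a := 1 + (n : ℝ) ^ 2
    set b := ‖fourierCoeff U n‖
    have ha : 0 < a := by positivity
    have h2 : 0 ≤ a⁻¹ * (1 - a ^ 2 * b) ^ 2 := by positivity
    have h3 : a⁻¹ * (1 - a ^ 2 * b) ^ 2 = a⁻¹ + a ^ 3 * b ^ 2 - 2 * (a * b) := by
      field_simp
      ring
    linarith
  have h2 := ((summable_inv_one_add_sq.hasSum.add (hasSum_normH hU)).div_const 2)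
  have h3 : Summable fun n => ‖fourierCoeff W n‖ :=
    Summable.of_nonneg_of_le (fun n => norm_nonneg _) h1 h2.summable
  filter_upwards [ae_norm_le_of_summable h3] with y hy
  refine hy.trans ((hasSum_le h1 h3.hasSum h2).trans ?_)
  unfold wienerBound
  have := pow_le_pow_left₀ (normH_nonneg 3 U) hM 2
  linarith

/-- The mean of `U (∂_yy - β²)⁻¹ U` is `-‖∂_y⁻¹ U‖²` up to `O(β²)`. -/
theorem norm_mean_mul_stream_add_le {U : L2T} (hU : MemLp U ⊤ tmeas)
    (hreal : ∀ᵐ y ∂tmeas, (U y).im = 0) (β : ℝ) :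
    ‖fourierCoeff (mulOp U hU (stream β U)) 0 + ((‖antideriv U‖ ^ 2 : ℝ) : ℂ)‖
      ≤ β ^ 2 * ‖U‖ ^ 2 := by
  have h1 := hasSum_fourierCoeff_mulOp_zero U hU (stream β U)
  have h2 : HasSum (fun n => ((‖fourierCoeff (antideriv U) n‖ ^ 2 : ℝ) : ℂ))
      ((‖antideriv U‖ ^ 2 : ℝ) : ℂ) := Complex.hasSum_ofReal.2 (hasSum_norm_sq (antideriv U))
  refine (h1.add h2).norm_le_of_bounded ((hasSum_norm_sq U).mul_left (β ^ 2)) fun n => ?_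
  rw [fourierCoeff_neg_of_real hreal, fourierCoeff_stream, fourierCoeff_antideriv]
  by_cases hn : n = 0
  · simp only [hn, if_true, mul_zero, norm_zero, ne_eq, OfNat.ofNat_ne_zero, not_false_eq_true,
      zero_pow, Complex.ofReal_zero, add_zero]
    positivity
  · rw [if_neg hn, if_neg hn]
    have h3 := one_le_sq_of_ne_zero hn
    have e1 : star (fourierCoeff U n) * fourierCoeff U n = ((‖fourierCoeff U n‖ ^ 2 : ℝ) : ℂ) := by
      rw [← starRingEnd_apply, Complex.conj_mul', Complex.ofReal_pow]
    have e2 : ‖fourierCoeff U n / (Complex.I * (n : ℂ))‖ ^ 2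
        = ‖fourierCoeff U n‖ ^ 2 / (n : ℝ) ^ 2 := by
      rw [norm_div, norm_mul, Complex.norm_I, one_mul, Complex.norm_intCast, div_pow, sq_abs]
    rw [mul_left_comm, e1, e2]
    set b := ‖fourierCoeff U n‖ ^ 2
    set a := (n : ℝ) ^ 2
    have hb : 0 ≤ b := by positivity
    have hβ := sq_nonneg β
    have e3 : -((β ^ 2 + a : ℝ) : ℂ)⁻¹ * (b : ℂ) + ((b / a : ℝ) : ℂ)
        = ((β ^ 2 * (b / (a * (β ^ 2 + a))) : ℝ) : ℂ) := by
      rw [← Complex.ofReal_inv, ← Complex.ofReal_neg, ← Complex.ofReal_mul, ← Complex.ofReal_add]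
      congr 1
      have : β ^ 2 + a ≠ 0 := by linarith
      field_simp
      ring
    rw [e3, Complex.norm_real, Real.norm_of_nonneg (by positivity)]
    refine mul_le_mul_of_nonneg_left (div_le_self hb ?_) hβ
    nlinarith

/-! ### The modes `e^{ikx} f(y)` -/

theorem coeFn_mode (k : ℤ) (f : L2T) :
    mode k f =ᵐ[tmeas2] fun p => fourier k p.1 * f p.2 := (memLp_mode k f).coeFn_toLp

theorem coeff2_fourier_mul (k : ℤ) (f : Torus → ℂ) (m n : ℤ) :
    coeff2 (fun p => fourier k p.1 * f p.2) m n = if m = k then fourierCoeff f n else 0 := by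
  have h : coeff2 (fun p => fourier k p.1 * f p.2) m n
      = (∫ x, fourier (-m) x * fourier k x ∂tmeas) * ∫ y, fourier (-n) y * f y ∂tmeas := by
    rw [← integral_prod_mul, coeff2]
    refine integral_congr_ae (Filter.Eventually.of_forall fun p => ?_)
    ring
  have h1 : ∫ x, fourier (-m) x * fourier k x ∂tmeas = (Pi.single k 1 : ℤ → ℂ) m := by
    rw [← fourierCoeff_fourier (T := 2 * Real.pi) k]
    rfl
  rw [h, h1, Pi.single_apply]
  split_ifs
  · rw [one_mul]
    rfl
  · rw [zero_mul]

theorem coeff2_mode (k : ℤ) (f : L2T) (m n : ℤ) :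
    coeff2 (mode k f) m n = if m = k then fourierCoeff f n else 0 := by
  rw [coeff2_congr (coeFn_mode k f), coeff2_fourier_mul]

theorem norm_mode (k : ℤ) (f : L2T) : ‖mode k f‖ = ‖f‖ := by
  rw [Lp.norm_def, Lp.norm_def, eLpNorm_congr_ae (coeFn_mode k f)]
  congr 1
  have h1 : eLpNorm (fun p : Torus × Torus => fourier k p.1 * f p.2) 2 tmeas2
      = eLpNorm (f ∘ Prod.snd) 2 tmeas2 :=
    eLpNorm_congr_norm_ae (Filter.Eventually.of_forall fun p => by
      simp only [fourier_apply, norm_mul, Circle.norm_coe, one_mul, Function.comp_apply])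
  rw [h1, eLpNorm_comp_measurePreserving (Lp.aestronglyMeasurable f) measurePreserving_snd]

theorem coeff2_transport_mode {U W : L2T} (hU : MemLp U ⊤ tmeas) (hW : MemLp W ⊤ tmeas) (k : ℤ)
    (f ψ : L2T) (m n : ℤ) : coeff2 (transport U W (mode k f) (mode k ψ)) m n
      = if m = k then fourierCoeff (mulOp U hU f) n - fourierCoeff (mulOp W hW ψ) n else 0 := by
  have h (V : L2T) (hV : MemLp V ⊤ tmeas) (g : L2T) :=
    (Measure.quasiMeasurePreserving_snd (μ := tmeas) (ν := tmeas)).ae_eq_comp (coeFn_mulOp V hV g)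
  rw [← fourierCoeff_coe_sub, ← coeff2_mode]
  refine coeff2_congr ?_ m n
  rw [map_sub]
  filter_upwards [h U hU f, h W hW ψ, coeFn_mode k f, coeFn_mode k ψ,
    coeFn_mode k (mulOp U hU f), coeFn_mode k (mulOp W hW ψ),
    Lp.coeFn_sub (mode k (mulOp U hU f)) (mode k (mulOp W hW ψ))] with p h1 h2 h3 h4 h5 h6 h7
  simp only [Function.comp_apply] at h1 h2
  rw [transport, h3, h4, h7, Pi.sub_apply, h5, h6, h1, h2]
  ring

theorem eq_of_coeff2 {v w : L2T2} (h : ∀ m n, coeff2 v m n = coeff2 w m n) : v = w := by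
  rw [← sub_eq_zero]
  refine eq_zero_of_coeff2 _ fun m n => ?_
  have : v - w = v + (-1 : ℂ) • w := by rw [neg_one_smul, sub_eq_add_neg]
  rw [this, coeff2_coe_add, coeff2_coe_smul, h]
  ring

theorem memH2T2_mode_iff (k : ℤ) (f : L2T) : MemH2T2 (mode k f) ↔
    Summable fun n : ℤ => (1 + (k : ℝ) ^ 2 + (n : ℝ) ^ 2) ^ 2 * ‖fourierCoeff f n‖ ^ 2 := by
  have hinj : Function.Injective fun n : ℤ => (k, n) := fun a b h => (Prod.ext_iff.1 h).2
  rw [MemH2T2, ← hinj.summable_iff]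
  · refine summable_congr fun n => ?_
    simp [coeff2_mode]
  · rintro ⟨m, n⟩ hmn
    have : m ≠ k := fun h => hmn ⟨n, by rw [h]⟩
    simp [coeff2_mode, this]

/-- Membership in the graph of `𝓛_{ν,α}` for functions of the form `e^{ikx} f(y)`. -/
theorem mode_mem_graph_iff {U : L2T} (hU : MemLp U ⊤ tmeas) (hW : MemLp (deriv2 U) ⊤ tmeas)
    {ν α : ℝ} {k : ℤ} (hν : ν ≠ 0) (hα : α ≠ 0) (hk : k ≠ 0) {f g ψ : L2T}
    (hψ : ∀ n, lapSymbol α k n * fourierCoeff ψ n = fourierCoeff f n) :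
    (mode k f, mode k g) ∈ graph U ν α ↔ ∀ n, fourierCoeff g n
      = ν * (lapSymbol α k n * fourierCoeff f n) - α * (Complex.I * k *
        (fourierCoeff (mulOp U hU f) n - fourierCoeff (mulOp (deriv2 U) hW ψ) n)) := by
  have hlap {m n : ℤ} (hmn : (m, n) ≠ (0, 0)) : lapSymbol α m n ≠ 0 := by
    unfold lapSymbol
    rw [neg_ne_zero, Complex.ofReal_ne_zero]
    intro h'
    have hm : (α * m) ^ 2 = 0 := by nlinarith [sq_nonneg (α * m), sq_nonneg (n : ℝ)]
    have hn : (n : ℝ) ^ 2 = 0 := by nlinarith [sq_nonneg (α * m), sq_nonneg (n : ℝ)]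
    exact hmn (Prod.ext (by simpa [hα] using hm) (by simpa using hn))
  have hstream : IsStream α (mode k f) (mode k ψ) := by
    refine ⟨by rw [coeff2_mode, if_neg hk.symm], fun m n _ => ?_⟩
    rw [coeff2_mode, coeff2_mode]
    split_ifs with h
    · rw [h, hψ]
    · rw [mul_zero]
  have huniq {ψ' : L2T2} (h : IsStream α (mode k f) ψ') : ψ' = mode k ψ := by
    refine eq_of_coeff2 fun m n => ?_
    by_cases hmn : (m, n) = (0, 0)
    · obtain ⟨rfl, rfl⟩ := Prod.mk.inj hmn
      rw [h.1, hstream.1]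
    · exact mul_left_cancel₀ (hlap hmn) ((h.2 m n hmn).trans (hstream.2 m n hmn).symm)
  constructor
  · rintro ⟨-, ψ', hψ', h⟩ n
    rw [huniq hψ'] at h
    have := h k n
    simpa only [coeff2_mode, coeff2_transport_mode hU hW, if_true] using this
  · intro h
    refine ⟨?_, mode k ψ, hstream, fun m n => ?_⟩
    · rw [memH2T2_mode_iff]
      set β := α * k with hβ
      have hβ0 : β ≠ 0 := mul_ne_zero hα (by exact_mod_cast hk)
      set q : L2T := (ν : ℂ)⁻¹ • (g + (α * (Complex.I * k)) • (mulOp U hU f - mulOp (deriv2 U) hW ψ))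
        with hq
      have hqn (n : ℤ) : fourierCoeff q n = lapSymbol α k n * fourierCoeff f n := by
        have hν' : (ν : ℂ) ≠ 0 := by exact_mod_cast hν
        rw [hq, fourierCoeff_coe_smul, fourierCoeff_coe_add, fourierCoeff_coe_smul,
          fourierCoeff_coe_sub, h n, inv_mul_eq_iff_eq_mul₀ hν']
        ring
      set c := (1 + (k : ℝ) ^ 2) / β ^ 2 + 1
      refine Summable.of_nonneg_of_le (fun n => by positivity) (fun n => ?_)
        ((hasSum_norm_sq q).summable.mul_left (c ^ 2))
      rw [hqn, norm_mul, mul_pow, ← mul_assoc, ← mul_pow c]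
      refine mul_le_mul_of_nonneg_right (pow_le_pow_left₀ (by positivity) ?_ 2) (by positivity)
      rw [lapSymbol, norm_neg, Complex.norm_real, Real.norm_of_nonneg (by positivity), ← hβ]
      have h1 : c * (β ^ 2 + (n : ℝ) ^ 2)
          = 1 + (k : ℝ) ^ 2 + (1 + (k : ℝ) ^ 2) / β ^ 2 * (n : ℝ) ^ 2 + β ^ 2 + (n : ℝ) ^ 2 := by
        simp only [c]
        field_simp
        ring
      rw [h1]
      have : 0 ≤ (1 + (k : ℝ) ^ 2) / β ^ 2 * (n : ℝ) ^ 2 + β ^ 2 := by positivity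
      linarith
    · simp only [coeff2_mode, coeff2_transport_mode hU hW]
      split_ifs with hm
      · rw [hm, h n]
      · simp

/-! ### Conjugation to a bounded perturbation of `∂_yy - β²` -/

theorem exists_bound_meanScale (a : ℂ) : ∃ c, ∀ n : ℤ, ‖(if n = 0 then a else 1 : ℂ)‖ ≤ c :=
  ⟨‖a‖ + 1, fun n => by split_ifs <;> simp⟩

/-- The multiplication of the mean of a function by `a ≠ 0`. -/
def meanScale {a : ℂ} (ha : a ≠ 0) : L2T ≃L[ℂ] L2T :=
  ContinuousLinearEquiv.equivOfInverse
    (fmul (fun n => if n = 0 then a else 1) (exists_bound_meanScale a))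
    (fmul (fun n => if n = 0 then a⁻¹ else 1) (exists_bound_meanScale _))
    (fun f => fourierCoeff_ext fun n => by
      rw [fourierCoeff_fmul, fourierCoeff_fmul]
      split_ifs
      · rw [inv_mul_cancel_left₀ ha]
      · simp)
    (fun f => fourierCoeff_ext fun n => by
      rw [fourierCoeff_fmul, fourierCoeff_fmul]
      split_ifs
      · rw [mul_inv_cancel_left₀ ha]
      · simp)

theorem fourierCoeff_meanScale {a : ℂ} (ha : a ≠ 0) (f : L2T) (n : ℤ) :
    fourierCoeff (meanScale ha f) n = (if n = 0 then a else 1) * fourierCoeff f n :=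
  fourierCoeff_fmul (exists_bound_meanScale a) f n

theorem mulOp_one (U : L2T) (hU : MemLp U ⊤ tmeas) : mulOp U hU one = U := by
  refine Lp.ext ?_
  have h : one =ᵐ[tmeas] (fourier 0 : Torus → ℂ) := by
    have := coeFn_fourierLp (T := 2 * Real.pi) 2 0
    rw [← coe_fourierBasis] at this
    exact this
  filter_upwards [coeFn_mulOp U hU one, h] with y h1 h2
  rw [h1, h2, fourier_zero, mul_one]

theorem meanScale_eq {a : ℂ} (ha : a ≠ 0) (h : L2T) :
    meanScale ha h = meanFree h + (a * fourierCoeff h 0) • one := fourierCoeff_ext fun n => by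
  rw [fourierCoeff_meanScale, fourierCoeff_coe_add, fourierCoeff_meanFree, fourierCoeff_coe_smul,
    fourierCoeff_one]
  split_ifs with hn
  · rw [hn]; ring
  · ring

theorem neg_sq_ne_zero {β : ℝ} (hβ : β ≠ 0) : -((β ^ 2 : ℝ) : ℂ) ≠ 0 := by
  rw [neg_ne_zero]
  exact_mod_cast pow_ne_zero 2 hβ

theorem mode_meanScale_mem_graph_iff {U : L2T} (hU : MemLp U ⊤ tmeas)
    (hW : MemLp (deriv2 U) ⊤ tmeas) (hU3 : MemH 3 U) (hU0 : fourierCoeff U 0 = 0)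
    {ν α β : ℝ} {k : ℤ} (hν : ν ≠ 0) (hα : α ≠ 0) (hk : k ≠ 0) (hβ : β = α * k) (hβ0 : β ≠ 0)
    (h r : L2T) :
    (mode k (meanScale (neg_sq_ne_zero hβ0) h),
      (ν : ℂ) • mode k (meanScale (neg_sq_ne_zero hβ0) r)) ∈ graph U ν α ↔
      PertRel (transportOp hU hW β) (β / ν) β h r := by
  have hν' : (ν : ℂ) ≠ 0 := by exact_mod_cast hν
  have hW0 : fourierCoeff (deriv2 U) 0 = 0 := by rw [fourierCoeff_deriv2 hU3, hU0, mul_zero]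
  set s : ℤ → ℂ := fun n => if n = 0 then -((β ^ 2 : ℝ) : ℂ) else 1 with hs
  have hs0 (n : ℤ) : s n ≠ 0 := by
    simp only [hs]
    split_ifs
    · exact neg_sq_ne_zero hβ0
    · exact one_ne_zero
  have hlap (n : ℤ) : lapSymbol α k n = -((β ^ 2 + (n : ℝ) ^ 2 : ℝ) : ℂ) := by
    rw [lapSymbol, hβ]
  rw [← map_smul, mode_mem_graph_iff hU hW hν hα hk (ψ := fourierCoeff h 0 • one + stream β h)]
  · refine forall_congr' fun n => ?_
    have key : fourierCoeff (mulOp U hU (meanScale (neg_sq_ne_zero hβ0) h)) n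
        - fourierCoeff (mulOp (deriv2 U) hW (fourierCoeff h 0 • one + stream β h)) n
        = s n * fourierCoeff (transportOp hU hW β h) n := by
      rw [meanScale_eq, map_add, map_smul, mulOp_one, map_add, map_smul, mulOp_one,
        fourierCoeff_coe_add, fourierCoeff_coe_add, fourierCoeff_coe_smul, fourierCoeff_coe_smul]
      by_cases hn : n = 0
      · have h1 := fourierCoeff_transport_zero hU hW β (fourierCoeff_deriv2 hU3) h
        rw [hn, fourierCoeff_transportOp_zero hU hW β hU0 hW0, hU0, hW0]
        simp only [hs, if_true]
        linear_combination h1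
      · rw [fourierCoeff_transportOp hU hW β n hn]
        simp only [hs, hn, if_false]
        ring
    rw [key, fourierCoeff_coe_smul, fourierCoeff_meanScale, fourierCoeff_meanScale, hlap]
    change (ν : ℂ) * (s n * _) = ν * (_ * (s n * _)) - _ ↔ _
    have e1 : (ν : ℂ) * (-((β ^ 2 + (n : ℝ) ^ 2 : ℝ) : ℂ) * (s n * fourierCoeff h n))
        - α * (Complex.I * k * (s n * fourierCoeff (transportOp hU hW β h) n))
        = ν * (s n * (-((β ^ 2 + (n : ℝ) ^ 2 : ℝ) : ℂ) * fourierCoeff h n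
          - Complex.I * ((β / ν : ℝ) : ℂ) * fourierCoeff (transportOp hU hW β h) n)) := by
      have : (β : ℂ) = α * k := by rw [hβ]; push_cast; rfl
      rw [Complex.ofReal_div, this]
      field_simp
    rw [e1, mul_right_inj' hν', mul_right_inj' (hs0 n)]
  · intro n
    rw [hlap, fourierCoeff_coe_add, fourierCoeff_coe_smul, fourierCoeff_one, fourierCoeff_stream,
      fourierCoeff_meanScale]
    by_cases hn : n = 0
    · simp [hn]
    · have hne : ((β ^ 2 + (n : ℝ) ^ 2 : ℝ) : ℂ) ≠ 0 := by
        have : β ^ 2 + (n : ℝ) ^ 2 ≠ 0 := by positivity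
        exact_mod_cast this
      simp only [hn, if_false, mul_zero, zero_add, one_mul]
      rw [neg_mul, neg_mul, mul_neg, neg_neg, mul_inv_cancel_left₀ hne]

/-! ### Transfer of spectral notions -/

section Transfer

variable {E : Type*} [NormedAddCommGroup E] [NormedSpace ℂ E] {A : E →ₗ.[ℂ] E}
  {J : L2T ≃L[ℂ] E} {c : ℂ} {Rel : L2T → L2T → Prop}

theorem isEigenvector_iff_of_graph
    (hA : ∀ h r, (J h, c • J r) ∈ A.graph ↔ Rel h r) (μ : ℂ) (h : L2T) :
    IsEigenvector A (c * μ) (J h) ↔ h ≠ 0 ∧ Rel h (μ • h) := by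
  rw [← hA, map_smul, smul_smul, LinearPMap.mem_graph_iff, IsEigenvector, Ne,
    map_eq_zero_iff J J.injective]
  refine and_congr_right fun _ => ⟨fun ⟨h1, h2⟩ => ⟨⟨_, h1⟩, rfl, h2⟩, ?_⟩
  rintro ⟨⟨y, hy⟩, h1, h2⟩
  simp only at h1
  subst h1
  exact ⟨hy, h2⟩

theorem inResolventSet_of_graph (hc : c ≠ 0)
    (hA : ∀ h r, (J h, c • J r) ∈ A.graph ↔ Rel h r) {μ : ℂ} {R : L2T →L[ℂ] L2T}
    (hR : IsResolventOf Rel μ R) : InResolventSet A (c * μ) := by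
  refine ⟨(J : L2T →L[ℂ] E) ∘L R ∘L (c⁻¹ • (J.symm : E →L[ℂ] L2T)), fun g => ?_, fun f => ?_⟩
  · have h1 := (hA _ _).2 (hR.1 (c⁻¹ • J.symm g))
    rw [LinearPMap.mem_graph_iff] at h1
    obtain ⟨y, h2, h3⟩ := h1
    simp only at h2 h3
    refine ⟨y, h2, ?_⟩
    rw [h3, h2, map_add, map_smul, map_smul, J.apply_symm_apply, smul_add, smul_smul,
      mul_inv_cancel₀ hc, one_smul, smul_smul, add_sub_cancel_right]
  · have h1 : (J (J.symm f), c • J (c⁻¹ • J.symm (A f))) ∈ A.graph := by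
      rw [map_smul, J.apply_symm_apply, J.apply_symm_apply, smul_smul, mul_inv_cancel₀ hc, one_smul]
      exact A.mem_graph f
    have h2 := hR.2 _ _ ((hA _ _).1 h1)
    change J (R (c⁻¹ • J.symm (A f - (c * μ) • (f : E)))) = f
    rw [J.symm.map_sub, J.symm.map_smul, smul_sub, smul_smul, inv_mul_cancel_left₀ hc, h2,
      J.apply_symm_apply]

theorem isSimpleEigenvalue_of_graph (hc : c ≠ 0)
    (hA : ∀ h r, (J h, c • J r) ∈ A.graph ↔ Rel h r) {μ : ℂ} {v : L2T} (hv : v ≠ 0)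
    (hvμ : Rel v (μ • v)) (huniq : ∀ h, Rel h (μ • h) → ∃ a : ℂ, h = a • v)
    (hjordan : ∀ (h : L2T) (a : ℂ), Rel h (a • v + μ • h) → a = 0) :
    IsSimpleEigenvalue A (c * μ) := by
  have hev (g : E) (hg : IsEigenvector A (c * μ) g) : ∃ a : ℂ, g = a • J v := by
    rw [← J.apply_symm_apply g, isEigenvector_iff_of_graph hA] at hg
    obtain ⟨a, ha⟩ := huniq _ hg.2
    exact ⟨a, by rw [← J.apply_symm_apply g, ha, map_smul]⟩
  refine ⟨⟨J v, (isEigenvector_iff_of_graph hA μ v).2 ⟨hv, hvμ⟩, hev⟩, fun h f hf hh => ?_⟩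
  obtain ⟨a, rfl⟩ := hev f hf
  have h1 : (J (J.symm h), c • J ((c⁻¹ * a) • v + μ • J.symm h)) ∈ A.graph := by
    rw [map_add, map_smul, map_smul, J.apply_symm_apply, smul_add, smul_smul, smul_smul,
      mul_inv_cancel_left₀ hc, ← hh, sub_add_cancel]
    exact A.mem_graph h
  have h2 := hjordan _ _ ((hA _ _).1 h1)
  rw [mul_eq_zero, or_iff_right (inv_ne_zero hc)] at h2
  exact hf.1 (by rw [h2, zero_smul])

theorem mem_graph_part {A : E →ₗ.[ℂ] E} {K : Submodule ℂ E} (x y : K) :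
    (x, y) ∈ (part A K).graph ↔ ((x : E), (y : E)) ∈ A.graph := by
  rw [LinearPMap.mem_graph_iff, LinearPMap.mem_graph_iff]
  constructor
  · rintro ⟨f, h1, h2⟩
    simp only at h1 h2
    subst h1 h2
    exact ⟨⟨_, f.2.choose⟩, rfl, (part_apply A K f).symm⟩
  · rintro ⟨⟨f, hf⟩, h1, h2⟩
    simp only at h1 h2
    subst h1
    exact ⟨⟨x, hf, by rw [h2]; exact y.2⟩, rfl, Subtype.ext h2⟩

end Transfer

/-- The map `f ↦ e^{ikx} f(y)` as an isometry. -/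
def modeIsometry (k : ℤ) : L2T →ₗᵢ[ℂ] L2T2 := ⟨mode k, norm_mode k⟩

/-- The map `f ↦ e^{ikx} f(y)` as an isomorphism onto the class. -/
def modeEquiv (k : ℤ) : L2T ≃L[ℂ] modeClass k :=
  (modeIsometry k).equivRange.toContinuousLinearEquiv

theorem mem_graph_orrSommerfeldMode_iff {U : L2T} (hU : MemLp U ⊤ tmeas)
    (hW : MemLp (deriv2 U) ⊤ tmeas) (hU3 : MemH 3 U) (hU0 : fourierCoeff U 0 = 0)
    {ν α β : ℝ} {k : ℤ} (hν : ν ≠ 0) (hα : α ≠ 0) (hk : k ≠ 0) (hβ : β = α * k) (hβ0 : β ≠ 0)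
    (h r : L2T) :
    ((meanScale (neg_sq_ne_zero hβ0)).trans (modeEquiv k) h,
      (ν : ℂ) • (meanScale (neg_sq_ne_zero hβ0)).trans (modeEquiv k) r)
        ∈ (orrSommerfeldMode U ν α k).graph ↔
      PertRel (transportOp hU hW β) (β / ν) β h r := by
  rw [orrSommerfeldMode, mem_graph_part, graph_orrSommerfeld U ν hα,
    ← mode_meanScale_mem_graph_iff hU hW hU3 hU0 hν hα hk hβ hβ0]
  rfl

/-! ### Asymptotics -/

theorem reducedResolvent_transportOp_one {U W : L2T} (hU : MemLp U ⊤ tmeas)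
    (hW : MemLp W ⊤ tmeas) (hUW : ∀ n : ℤ, fourierCoeff W n = -((n : ℂ) ^ 2) * fourierCoeff U n)
    (hU0 : fourierCoeff U 0 = 0) {ε β : ℝ} {μ : ℂ} {G : L2T →L[ℂ] L2T}
    (hG : IsReducedResolvent (transportOp hU hW β) ε β μ G) :
    G (transportOp hU hW β one) = -U - G ((2 * ((β ^ 2 : ℝ) : ℂ) + μ) • U
      + (Complex.I * ε) • transportOp hU hW β U) := by
  rw [eq_sub_iff_add_eq, ← map_add]
  refine Eq.symm ((hG.2 _ _).2 ⟨by rw [fourierCoeff_coe_neg, hU0, neg_zero], fun n _ => ?_⟩)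
  rw [transportOp_one, map_neg]
  simp only [fourierCoeff_coe_neg, fourierCoeff_coe_add, fourierCoeff_coe_smul, hUW]
  push_cast
  ring

/-- A bound for the norm of the conjugated transport operator. -/
def transportBound (M : ℝ) : ℝ := 3 * wienerBound M + 2 * M

/-- The constant in the first-order expansion of the eigenfunction. -/
def expansionConst (M : ℝ) : ℝ :=
  4 * ((3 * M ^ 2 + 4 * transportBound M ^ 2 + transportBound M) * M)

/-- First-order expansion of the eigenfunction and second-order expansion of the eigenvalue. -/
theorem eigenvalue_expansion {U : L2T} {M : ℝ} (hM : 1 ≤ M) (hU : MemLp U ⊤ tmeas)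
    (hW : MemLp (deriv2 U) ⊤ tmeas) (hU3 : MemH 3 U) (hU0 : fourierCoeff U 0 = 0)
    (hreal : ∀ᵐ y ∂tmeas, (U y).im = 0) (hUM : ‖U‖ ≤ M) {ε β ν : ℝ} (hβ : β = ε * ν)
    (hν : 0 ≤ ν) (hνM : ν ≤ M) (hε : |ε| ≤ 1) (hK : ‖transportOp hU hW β‖ ≤ transportBound M)
    {μ : ℂ} (hμ : ‖μ‖ ≤ β ^ 2 + 4 * transportBound M ^ 2 * ε ^ 2) {G : L2T →L[ℂ] L2T}
    (hG : IsReducedResolvent (transportOp hU hW β) ε β μ G)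
    (hF : schur (transportOp hU hW β) ε β μ G = 0) :
    ‖G (transportOp hU hW β one) + U‖ ≤ expansionConst M * |ε| ∧
    ‖μ - ((ε ^ 2 * ‖antideriv U‖ ^ 2 - β ^ 2 : ℝ) : ℂ)‖
      ≤ (M ^ 4 + transportBound M * expansionConst M) * |ε| ^ 3 := by
  set K := transportOp hU hW β
  set κ := transportBound M
  have hκ : 0 ≤ κ := (norm_nonneg _).trans hK
  have hW0 : fourierCoeff (deriv2 U) 0 = 0 := by rw [fourierCoeff_deriv2 hU3, hU0, mul_zero]
  have hε2 : ε ^ 2 ≤ |ε| := by rw [← sq_abs]; nlinarith [abs_nonneg ε]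
  have hν2 : ν ^ 2 ≤ M ^ 2 := pow_le_pow_left₀ hν hνM 2
  have hβ2 : β ^ 2 ≤ M ^ 2 * |ε| := by
    rw [hβ, mul_pow]
    calc ε ^ 2 * ν ^ 2 ≤ |ε| * M ^ 2 := by gcongr
      _ = _ := mul_comm _ _
  set rem := (2 * ((β ^ 2 : ℝ) : ℂ) + μ) • U + (Complex.I * ε) • K U with hrem
  have hGK : G (K one) = -U - G rem :=
    reducedResolvent_transportOp_one hU hW (fourierCoeff_deriv2 hU3) hU0 hG
  have hremn : ‖rem‖ ≤ |ε| * ((3 * M ^ 2 + 4 * κ ^ 2 + κ) * M) := by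
    have e1 : ‖2 * ((β ^ 2 : ℝ) : ℂ) + μ‖ ≤ |ε| * (3 * M ^ 2 + 4 * κ ^ 2) := by
      refine (norm_add_le _ _).trans ?_
      rw [norm_mul, Complex.norm_ofNat, Complex.norm_real, Real.norm_of_nonneg (sq_nonneg β)]
      nlinarith [sq_nonneg κ]
    have e2 : ‖K U‖ ≤ κ * M := (K.le_of_opNorm_le hK U).trans (mul_le_mul_of_nonneg_left hUM hκ)
    refine (norm_add_le _ _).trans ?_
    rw [norm_smul, norm_smul, norm_mul, Complex.norm_I, one_mul, Complex.norm_real,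
      Real.norm_eq_abs]
    calc _ ≤ |ε| * (3 * M ^ 2 + 4 * κ ^ 2) * M + |ε| * (κ * M) := by gcongr
      _ = _ := by ring
  have hGrem : ‖G rem‖ ≤ expansionConst M * |ε| := by
    refine (G.le_of_opNorm_le hG.1 rem).trans ?_
    rw [expansionConst]
    linarith
  refine ⟨?_, ?_⟩
  · rw [hGK]
    have : -U - G rem + U = -G rem := by abel
    rwa [this, norm_neg]
  · have e1 : fourierCoeff (K (G (K one))) 0
        = -fourierCoeff (mulOp U hU (stream β U)) 0 - fourierCoeff (K (G rem)) 0 := by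
      rw [hGK, map_sub, map_neg, fourierCoeff_coe_sub, fourierCoeff_coe_neg,
        fourierCoeff_transportOp_zero hU hW β hU0 hW0 U]
    have e2 : μ - ((ε ^ 2 * ‖antideriv U‖ ^ 2 - β ^ 2 : ℝ) : ℂ) = -((ε : ℂ) ^ 2 *
        ((fourierCoeff (mulOp U hU (stream β U)) 0 + ((‖antideriv U‖ ^ 2 : ℝ) : ℂ))
          + fourierCoeff (K (G rem)) 0)) := by
      rw [schur, e1] at hF
      push_cast at hF ⊢
      linear_combination -hF
    rw [e2, norm_neg, norm_mul, norm_pow, Complex.norm_real, Real.norm_eq_abs]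
    have e3 := norm_mean_mul_stream_add_le hU hreal β
    have e4 := norm_coeff_comp_le hK hGrem
    have e5 : β ^ 2 * ‖U‖ ^ 2 ≤ M ^ 2 * |ε| * M ^ 2 := by gcongr
    calc _ ≤ |ε| ^ 2 * (M ^ 2 * |ε| * M ^ 2 + κ * (expansionConst M * |ε|)) := by
          gcongr
          exact (norm_add_le _ _).trans (add_le_add (e3.trans e5) e4)
      _ = _ := by ring

theorem meanScale_eigenfunction_sub {ε β ν : ℝ} (hβε : β = ε * ν) (hβ0 : β ≠ 0) (hε0 : ε ≠ 0)
    {g : L2T} (hg : fourierCoeff g 0 = 0) (U : L2T) :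
    meanScale (neg_sq_ne_zero hβ0) ((Complex.I / ε) • (one + (Complex.I * ε) • g)) - U
      = -((Complex.I * ((ε * ν ^ 2 : ℝ) : ℂ)) • one) - (g + U) := by
  have hεne : (ε : ℂ) ≠ 0 := by exact_mod_cast hε0
  have hI : Complex.I / ε * (Complex.I * ε) = -1 := by
    rw [div_mul_eq_mul_div, ← mul_assoc, Complex.I_mul_I, mul_div_cancel_right₀ _ hεne]
  refine fourierCoeff_ext fun n => ?_
  simp only [fourierCoeff_coe_sub, fourierCoeff_meanScale, fourierCoeff_coe_smul,
    fourierCoeff_coe_add, fourierCoeff_coe_neg, fourierCoeff_one]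
  split_ifs with hn
  · rw [hn, hg, hβε]
    push_cast
    field_simp
    ring
  · linear_combination fourierCoeff g n * hI

/-- The spectrum of `𝓛_{ν,α}` in the class `{e^{ikx} f(y)}`, with the expansions of the leading
eigenvalue `ν μ` and of its eigenfunction. -/
theorem exists_leading_eigenvalue {U : L2T} {M : ℝ} (hM : 1 ≤ M)
    (hreal : ∀ᵐ y ∂tmeas, (U y).im = 0) (hU3 : MemH 3 U) (hUM : normH 3 U ≤ M)
    (hmean : ∫ y, U y ∂tmeas = 0) {ν α β ε : ℝ} {k : ℤ} (hν : 0 < ν) (hα : 0 < α) (hk : k ≠ 0)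
    (hνU : ν < ‖antideriv U‖) (hβ : β = α * k) (hβ0 : β ≠ 0) (hε : ε = β / ν)
    (hεκ : |ε| * transportBound M ≤ 1 / 8) :
    ∃ (μ : ℂ) (V : L2T),
      IsEigenvector (orrSommerfeldMode U ν α k) (ν * μ) (modeElem k V) ∧
      IsSimpleEigenvalue (orrSommerfeldMode U ν α k) (ν * μ) ∧
      ‖μ‖ < 1 / 2 ∧
      (∀ μ' : ℂ, ν * μ' ∈ spec (orrSommerfeldMode U ν α k) → μ' ≠ μ →
        IsEigenvalue (orrSommerfeldMode U ν α k) (ν * μ') ∧ μ'.re ≤ -(1 / 2)) ∧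
      ‖μ - ((ε ^ 2 * ‖antideriv U‖ ^ 2 - β ^ 2 : ℝ) : ℂ)‖
        ≤ (M ^ 4 + transportBound M * expansionConst M) * |ε| ^ 3 ∧
      ‖V - U‖ ≤ (M ^ 2 + expansionConst M) * |ε| := by
  have hw := wienerBound_nonneg M
  have hκ : 2 * M ≤ transportBound M := by rw [transportBound]; linarith
  have hU0 : fourierCoeff U 0 = 0 := (fourierCoeff_zero_eq_integral U).trans hmean
  have hUn : ‖U‖ ≤ M := (norm_le_normH hU3).trans hUM
  have hWn : ‖deriv2 U‖ ≤ M := (norm_deriv2_le hU3).trans hUM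
  have hUb : ∀ᵐ y ∂tmeas, ‖U y‖ ≤ wienerBound M := ae_norm_le_wienerBound hU3 hUM fun n =>
    le_mul_of_one_le_left (norm_nonneg _) (by nlinarith [sq_nonneg (n : ℝ)])
  have hWb : ∀ᵐ y ∂tmeas, ‖deriv2 U y‖ ≤ wienerBound M :=
    ae_norm_le_wienerBound hU3 hUM fun n => by
      rw [fourierCoeff_deriv2 hU3, norm_mul, norm_neg, norm_pow, Complex.norm_intCast, sq_abs]
      exact mul_le_mul_of_nonneg_right (by linarith) (norm_nonneg _)
  have hU : MemLp U ⊤ tmeas := memLp_top_of_bound (Lp.aestronglyMeasurable U) _ hUb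
  have hW : MemLp (deriv2 U) ⊤ tmeas := memLp_top_of_bound (Lp.aestronglyMeasurable _) _ hWb
  have hνM : ν ≤ M := hνU.le.trans ((norm_antideriv_le U).trans hUn)
  have hε0 : ε ≠ 0 := hε ▸ div_ne_zero hβ0 hν.ne'
  have hβε : β = ε * ν := by rw [hε, div_mul_cancel₀ _ hν.ne']
  have hβ2 : β ^ 2 ≤ 1 / 8 := by
    have : |β| ≤ 1 / 8 := by
      rw [hβε, abs_mul, abs_of_pos hν]
      calc |ε| * ν ≤ |ε| * transportBound M := by gcongr; linarith
        _ ≤ 1 / 8 := hεκ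
    rw [← sq_abs]
    nlinarith [abs_nonneg β]
  have hK : ‖transportOp hU hW β‖ ≤ transportBound M :=
    norm_transportOp_le hU hW β (norm_mulOp_le hU hw hUb) (norm_mulOp_le hW hw hWb) hUn hWn
      (by linarith)
  have hK0 : fourierCoeff (transportOp hU hW β one) 0 = 0 := by
    rw [transportOp_one, fourierCoeff_coe_neg, fourierCoeff_coe_add, fourierCoeff_coe_smul, hU0,
      fourierCoeff_deriv2 hU3, hU0]
    simp
  obtain ⟨μ, G, hμ, hG, hF, hev, hjordan, hspec⟩ := exists_simple_eigenvalue hK hεκ hβ2 hK0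
  obtain ⟨hVexp, hμexp⟩ := eigenvalue_expansion hM hU hW hU3 hU0 hreal hUn hβε hν.le hνM
    (by nlinarith [abs_nonneg ε]) hK hμ hG hF
  have hν' : (ν : ℂ) ≠ 0 := by exact_mod_cast hν.ne'
  have hA := mem_graph_orrSommerfeldMode_iff hU hW hU3 hU0 hν.ne' hα.ne' hk hβ hβ0
  rw [← hε] at hA
  generalize transportOp hU hW β = K at *
  have hGm : fourierCoeff (G (K one)) 0 = 0 := ((hG.2 _ _).1 rfl).1
  generalize G (K one) = g at *
  obtain ⟨v, hv⟩ : ∃ v, v = one + (Complex.I * ε) • g := ⟨_, rfl⟩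
  rw [← hv] at hev hjordan
  have hv0 : fourierCoeff v 0 = 1 := by
    rw [hv, fourierCoeff_coe_add, fourierCoeff_coe_smul, fourierCoeff_one, if_pos rfl, hGm,
      mul_zero, add_zero]
  have hvne : v ≠ 0 := fun h => by
    rw [h, fourierCoeff_coe_zero] at hv0
    exact zero_ne_one hv0
  have hvμ : PertRel K ε β v (μ • v) := (hev v).2 (by rw [hv0, one_smul])
  have hIε : Complex.I / (ε : ℂ) ≠ 0 :=
    div_ne_zero Complex.I_ne_zero (by exact_mod_cast hε0)
  refine ⟨μ, meanScale (neg_sq_ne_zero hβ0) ((Complex.I / ε) • v), ?_, ?_, ?_, ?_, hμexp, ?_⟩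
  · exact (isEigenvector_iff_of_graph hA μ ((Complex.I / ε) • v)).2
      ⟨smul_ne_zero hIε hvne, by rw [smul_comm]; exact hvμ.smul _⟩
  · exact isSimpleEigenvalue_of_graph hν' hA hvne hvμ (fun h hh => ⟨_, (hev h).1 hh⟩) hjordan
  · have : transportBound M ^ 2 * ε ^ 2 ≤ 1 / 64 := by
      rw [← sq_abs ε, ← mul_pow, mul_comm]
      nlinarith [mul_nonneg (abs_nonneg ε) (by linarith : 0 ≤ transportBound M)]
    linarith
  · intro μ' hz hne
    obtain ⟨h1, h, hh, hh'⟩ := hspec μ'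
      (fun ⟨R, hR⟩ => hz (inResolventSet_of_graph hν' hA hR)) hne
    exact ⟨⟨_, (isEigenvector_iff_of_graph hA μ' h).2 ⟨hh, hh'⟩⟩, h1⟩
  · rw [hv, meanScale_eigenfunction_sub hβε hβ0 hε0 hGm]
    refine (norm_sub_le _ _).trans ?_
    rw [norm_neg, norm_smul, norm_mul, Complex.norm_I, one_mul, Complex.norm_real, norm_one_L2T,
      mul_one, Real.norm_eq_abs, abs_mul, abs_of_nonneg (sq_nonneg ν)]
    have hν2 : ν ^ 2 ≤ M ^ 2 := pow_le_pow_left₀ hν.le hνM 2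
    calc _ ≤ |ε| * M ^ 2 + expansionConst M * |ε| := by gcongr
      _ = _ := by ring

end OrrSommerfeld
end

open OrrSommerfeld in
theorem theorem1p1 (M : ℝ) :
    ∃ δ₀ C : ℝ, 0 < δ₀ ∧ δ₀ < 1 ∧ 1 ≤ C ∧
      ∀ U : OrrSommerfeld.L2T,
        (∀ᵐ y ∂OrrSommerfeld.tmeas, (U y).im = 0) →
        OrrSommerfeld.MemH 3 U → OrrSommerfeld.normH 3 U ≤ M →
        ∫ y, U y ∂OrrSommerfeld.tmeas = 0 →
        ∀ (ν α : ℝ) (k : ℤ), 0 < ν → 0 < α → k ≠ 0 →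
          ν < ‖OrrSommerfeld.antideriv U‖ → α * |(k : ℝ)| ≤ δ₀ * ν →
          ∃ (lam : ℂ) (V : OrrSommerfeld.L2T),
            OrrSommerfeld.IsEigenvector (OrrSommerfeld.orrSommerfeldMode U ν α k) lam
              (OrrSommerfeld.modeElem k V) ∧
            OrrSommerfeld.IsSimpleEigenvalue (OrrSommerfeld.orrSommerfeldMode U ν α k) lam ∧
            -(ν / 2) < lam.re ∧
            (∀ z ∈ OrrSommerfeld.spec (OrrSommerfeld.orrSommerfeldMode U ν α k), z ≠ lam →
              OrrSommerfeld.IsEigenvalue (OrrSommerfeld.orrSommerfeldMode U ν α k) z ∧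
              z.re ≤ -(ν / 2)) ∧
            ‖lam - (((α * k) ^ 2 / ν * (‖OrrSommerfeld.antideriv U‖ ^ 2 - ν ^ 2) : ℝ) : ℂ)‖
              ≤ C * ((α * |(k : ℝ)|) ^ 3 / ν ^ 2) ∧
            ‖V - U‖ ≤ C * (α * |(k : ℝ)| / ν) ∧
            (C * (α * |(k : ℝ)| / ν) < ‖OrrSommerfeld.antideriv U‖ ^ 2 - ν ^ 2 → 0 < lam.re) := by
  obtain ⟨M₁, hM₁⟩ : ∃ M₁, M₁ = max M 1 := ⟨_, rfl⟩
  have hM1 : 1 ≤ M₁ := hM₁ ▸ le_max_right _ _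
  have hw := wienerBound_nonneg M₁
  obtain ⟨κ, hκdef⟩ : ∃ κ, κ = transportBound M₁ := ⟨_, rfl⟩
  have hκ : 2 * M₁ ≤ κ := by rw [hκdef, transportBound]; linarith
  have hκ0 : 0 < κ := by linarith
  obtain ⟨D, hDdef⟩ : ∃ D, D = expansionConst M₁ := ⟨_, rfl⟩
  have hD : 0 ≤ D := by rw [hDdef, expansionConst, ← hκdef]; positivity
  obtain ⟨C, hC⟩ : ∃ C, C = 1 + (M₁ ^ 2 + D) + (M₁ ^ 4 + κ * D) := ⟨_, rfl⟩
  have hC1 : 0 ≤ M₁ ^ 2 + D := by positivity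
  have hC2 : 0 ≤ M₁ ^ 4 + κ * D := by positivity
  have hδ1 : 1 / (8 * κ) ≤ 1 / 16 := one_div_le_one_div_of_le (by norm_num) (by linarith)
  refine ⟨1 / (8 * κ), C, by positivity, by linarith, by linarith, ?_⟩
  intro U hreal hU3 hUM hmean ν α k hν hα hk hνU hsmall
  have hk' : (k : ℝ) ≠ 0 := by exact_mod_cast hk
  obtain ⟨β, hβ⟩ : ∃ β, β = α * k := ⟨_, rfl⟩
  have hβ0 : β ≠ 0 := hβ ▸ mul_ne_zero hα.ne' hk'
  have hβabs : α * |(k : ℝ)| = |β| := by rw [hβ, abs_mul, abs_of_pos hα]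
  rw [hβabs] at hsmall
  obtain ⟨ε, hε⟩ : ∃ ε, ε = β / ν := ⟨_, rfl⟩
  have hεabs : |β| / ν = |ε| := by rw [hε, abs_div, abs_of_pos hν]
  have hεκ : |ε| * κ ≤ 1 / 8 := by
    have hεδ : |ε| ≤ 1 / (8 * κ) := by rw [← hεabs, div_le_iff₀ hν]; exact hsmall
    calc |ε| * κ ≤ 1 / (8 * κ) * κ := by gcongr
      _ = 1 / 8 := by field_simp
  obtain ⟨μ, V, hV, hsimple, hμ, hspec, hμexp, hVU⟩ := exists_leading_eigenvalue hM1 hreal hU3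
    (hUM.trans (hM₁ ▸ le_max_left _ _)) hmean hν hα hk hνU hβ hβ0 hε (hκdef ▸ hεκ)
  rw [← hκdef, ← hDdef] at hμexp
  rw [← hDdef] at hVU
  have hlam : ‖ν * μ - ((β ^ 2 / ν * (‖antideriv U‖ ^ 2 - ν ^ 2) : ℝ) : ℂ)‖
      ≤ C * (|β| ^ 3 / ν ^ 2) := by
    have e1 : (β ^ 2 / ν * (‖antideriv U‖ ^ 2 - ν ^ 2) : ℝ)
        = ν * (ε ^ 2 * ‖antideriv U‖ ^ 2 - β ^ 2) := by
      rw [hε]; field_simp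
    have e2 : |β| ^ 3 / ν ^ 2 = ν * |ε| ^ 3 := by
      rw [← hεabs]; field_simp
    rw [e1, e2, Complex.ofReal_mul, ← mul_sub, norm_mul, Complex.norm_real,
      Real.norm_of_nonneg hν.le, mul_left_comm]
    refine mul_le_mul_of_nonneg_left (hμexp.trans ?_) hν.le
    exact mul_le_mul_of_nonneg_right (by linarith) (by positivity)
  rw [hβabs, ← hβ]
  refine ⟨ν * μ, V, hV, hsimple, ?_, fun z hz hne => ?_, hlam, ?_, fun h => ?_⟩
  · rw [Complex.re_ofReal_mul]
    have := (abs_le.1 (Complex.abs_re_le_norm μ)).1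
    nlinarith
  · have hν' : (ν : ℂ) ≠ 0 := by exact_mod_cast hν.ne'
    obtain ⟨μ', rfl⟩ : ∃ μ', z = ν * μ' := ⟨z / ν, by field_simp⟩
    obtain ⟨h1, h2⟩ := hspec μ' hz fun h => hne (by rw [h])
    refine ⟨h1, ?_⟩
    rw [Complex.re_ofReal_mul]
    nlinarith
  · rw [hεabs]
    exact hVU.trans (mul_le_mul_of_nonneg_right (by linarith) (abs_nonneg ε))
  · rw [hεabs] at h
    have h1 := (Complex.abs_re_le_norm _).trans hlam
    rw [Complex.sub_re, Complex.ofReal_re] at h1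
    have h2 := (abs_le.1 h1).1
    have e1 : C * (|β| ^ 3 / ν ^ 2) = β ^ 2 / ν * (C * |ε|) := by
      rw [← hεabs, ← sq_abs β]; field_simp
    have h3 : 0 < β ^ 2 / ν := by positivity
    have h4 := mul_lt_mul_of_pos_left h h3
    linarith
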